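/- A tournament is a loopless directed graph with finitely many vertices in which, for any two distinct vertices $u$ and $v$, exactly one of the edges $u \to v$ and $v \to u$ is present. A subtournament of a tournament is a tournament induced on a subset of its vertices, and a tournament is transitive if it has no cyclic triangle, that is, no vertices $a, b, c$ with $a \to b \to c \to a$. For a tournament $H$, a tournament $G$ is $H$-free if no subtournament of $G$ is isomorphic to $H$. Let $U_5$ be the tournament with vertices $v_1, \dots, v_5$ such that $v_2 \to v_1$, and $v_i \to v_j$ if $j - i \equiv 1, 2 \pmod 5$ and $\{i,j\} \neq \{1,2\}$. Let $T_3$ be the tournament with vertices $v_1, v_2, v_3$ such that $v_1 \to v_2 \to v_3 \to v_1$. For tournaments $H_1, H_2, H_3$, let $T_3(H_1, H_2, H_3)$ be the tournament whose vertex set is the union of disjoint sets $V_1, V_2, V_3$ such that the subtournament induced on $V_i$ is isomorphic to $H_i$ for each $i$, and $x \to y$ for all $x \in V_i$, $y \in V_j$ with $(i,j) \in \{(1,2),(2,3),(3,1)\}$. Define $G_1 = T_3$ and $G_{n+1} = T_3(G_n, G_n, G_n)$ for $n \geq 1$. Theorem. (1) Every $U_5$-free tournament $G$ has a transitive subtournament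 with at least $|V(G)|^{\log_3 2}$ vertices. (2) The bound is tight: for every $n \geq 1$, the tournament $G_n$ is $U_5$-free, has exactly $3^n$ vertices, and has no transitive subtournament with more than $2^n = |V(G_n)|^{\log_3 2}$ vertices. (3) In particular, there are infinitely many integers $m$ for which there is a $U_5$-free tournament with $m$ vertices that has no transitive subtournament with more than $m^{\log_3 2}$ vertices. -/

import Mathlib

/-- A tournament on the vertex set `V`: a loopless directed graph such that, for any two distinct
vertices `u` and `v`, exactly one of the edges `u → v` and `v → u` is present. -/
structure Tournament (V : Type*) extends Digraph V where
  loopless : ∀ v, ¬ Adj v v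
  exactly_one : ∀ u v, u ≠ v → Xor (Adj u v) (Adj v u)

namespace Tournament

/-- The subtournament `G[X]` of `G` induced on the set `X` of vertices. -/
def induce {V : Type*} (G : Tournament V) (X : Set V) : Tournament X where
  Adj u v := G.Adj u v
  loopless v := G.loopless v
  exactly_one u v h := G.exactly_one u v (fun e => h (Subtype.ext e))

/-- Isomorphism of tournaments. -/
def Isomorphic {V W : Type*} (G : Tournament V) (H : Tournament W) : Prop :=
  Nonempty (G.Adj ≃r H.Adj)

/-- `G` is `H`-free if no subtournament of `G` is isomorphic to `H`. -/
def IsFree {V W : Type*} (G : Tournament V) (H : Tournament W) : Prop :=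
  ∀ X : Set V, ¬ (G.induce X).Isomorphic H

/-- A tournament is transitive if it has no cyclic triangle. (A triple with `a → b → c → a`
consists automatically of three distinct vertices.) -/
def IsTransitive {V : Type*} (G : Tournament V) : Prop :=
  ¬ ∃ a b c, G.Adj a b ∧ G.Adj b c ∧ G.Adj c a

/-- The tournament `U₅`. Its vertices `v₁, …, v₅` are the elements `0, …, 4` of `Fin 5`, where
subtraction is modulo 5: `v₂ → v₁`, and `vᵢ → vⱼ` if `j - i ≡ 1, 2 (mod 5)` and
`{i, j} ≠ {1, 2}`. -/
def U5 : Tournament (Fin 5) where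
  Adj i j := (i = 1 ∧ j = 0) ∨
    ((j - i = 1 ∨ j - i = 2) ∧ ({i, j} : Finset (Fin 5)) ≠ {0, 1})
  loopless := by decide
  exactly_one := by unfold Xor; decide

/-- The tournament `T₃`, that is, the cyclic triangle `0 → 1 → 2 → 0`
(subtraction in `Fin 3` is modulo 3). -/
def T3 : Tournament (Fin 3) where
  Adj i j := j - i = 1
  loopless := by decide
  exactly_one := by unfold Xor; decide

/-- The tournament with a single vertex. -/
def point : Tournament Unit where
  Adj _ _ := False
  loopless _ h := h
  exactly_one u v h := (h (Subsingleton.elim u v)).elim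

/-- The substitution `G(Hᵢ : i)`: the vertex set is the disjoint union of the vertex sets `V i` of
the `H i`, the tournament induced on `V i` is `H i`, and every vertex of `V i` is joined to every
vertex of `V j` by an edge from the former to the latter if `i → j` in `G`. -/
def subst {ι : Type*} {V : ι → Type*} (G : Tournament ι) (H : ∀ i, Tournament (V i)) :
    Tournament (Σ i, V i) where
  Adj := Sigma.Lex G.Adj (fun i => (H i).Adj)
  loopless := by
    rintro ⟨i, v⟩ h
    rcases Sigma.lex_iff.1 h with h | ⟨_, h⟩
    · exact G.loopless i h
    · exact (H i).loopless v h
  exactly_one := by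
    rintro ⟨i, u⟩ ⟨j, v⟩ h
    by_cases hij : i = j
    · subst hij
      have huv : u ≠ v := fun e => h (by rw [e])
      have hG := G.loopless i
      simpa [Sigma.lex_iff, hG] using (H i).exactly_one u v huv
    · have hji : j ≠ i := fun e => hij e.symm
      simpa [Sigma.lex_iff, hij, hji] using G.exactly_one i j hij

/-- The vertex sets of the iterated substitutions of `T₃` into itself. -/
def IterVertex : ℕ → Type
  | 0 => Unit
  | 1 => Fin 3
  | n + 2 => Σ _ : Fin 3, IterVertex (n + 1)

/-- The iterated substitutions `G₁ = T₃` and `G_{n+1} = T₃(G_n, G_n, G_n)` for `n ≥ 1`.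
By convention `G₀` is the tournament with one vertex. -/
def iterT3 : (n : ℕ) → Tournament (IterVertex n)
  | 0 => point
  | 1 => T3
  | n + 2 => T3.subst (fun _ => iterT3 (n + 1))

end Tournament

namespace Tournament

/-! ### Forbidden configurations and linked cyclic triangles. -/

variable {V : Type*} (G : Tournament V)

/-! Put p = log_2 3. The lower bound is proved in the weighted form `HasHeavySet`: for all
nonnegative weights, some acyclic X ⊆ S satisfies ∑_S w^p ≤ (∑_X w)^p. Unit weights give the
theorem. Arbitrary weights allow a homogeneous set to be collapsed to one vertex carrying the weight
of a heavy acyclic set inside it, so strong induction reduces to prime tournaments.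

A prime U₅-free tournament with a cyclic triangle has one of two structures (`NoU5.structure`). If
it contains the regular five-vertex tournament, it is locally transitive; then deleting any vertex
leaves a pair of twins, so one deletes a lightest vertex and merges the twins
(`HasHeavySet.of_twins`). Otherwise a colouring by `ZMod 3`, grown one vertex at a time, gives all
three colours to every cyclic triangle, and one deletes a lightest colour class
(`HasHeavySet.of_coloring`). Both deletions are paid for by x^p + 2y^p ≤ (x+y)^p for 0 ≤ y ≤ x,
where 2^p = 3 enters.

For tightness, a map from U₅ to T₃ that preserves or collapses every edge is constant, so
substitution into T₃ creates no U₅. A transitive set in T₃(H, H, H) misses one of the three parts,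
so its maximal size at most doubles while the order triples. -/

theorem asymm {x y : V} (h : G.Adj x y) : ¬ G.Adj y x := by
  intro h'
  have hne : x ≠ y := fun e => G.loopless x (by rw [← e] at h; exact h)
  rcases G.exactly_one x y hne with h1 | h1
  · exact h1.2 h'
  · exact h1.2 h

theorem total {x y : V} (h : x ≠ y) : G.Adj x y ∨ G.Adj y x :=
  (G.exactly_one x y h).elim (fun h => Or.inl h.1) (fun h => Or.inr h.1)

theorem ne_of_adj {x y : V} (h : G.Adj x y) : x ≠ y := by
  rintro rfl
  exact G.loopless x h

/-- The tournament with all edges reversed. -/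
def reverse : Tournament V where
  Adj u v := G.Adj v u
  loopless := G.loopless
  exactly_one u v h := G.exactly_one v u h.symm

/-- A cyclic triangle `a → b → c → a`. -/
def Cyc (a b c : V) : Prop := G.Adj a b ∧ G.Adj b c ∧ G.Adj c a

/-- No five vertices carry a copy of `U₅`. -/
def NoU5 : Prop := ∀ a b c d e, G.Adj b a → G.Adj a c → G.Adj b c → G.Adj b d → G.Adj c d →
  G.Adj c e → G.Adj d e → G.Adj d a → G.Adj e a → G.Adj e b → False

/-- A copy of the regular tournament on five vertices. -/
def Pent (a b c d e : V) : Prop := G.Adj a b ∧ G.Adj a c ∧ G.Adj b c ∧ G.Adj b d ∧ G.Adj c d ∧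
  G.Adj c e ∧ G.Adj d e ∧ G.Adj d a ∧ G.Adj e a ∧ G.Adj e b

/-- A set which no vertex outside of it distinguishes. -/
def Homogeneous (A : Set V) : Prop :=
  ∀ v, v ∉ A → (∀ a ∈ A, G.Adj v a) ∨ (∀ a ∈ A, G.Adj a v)

/-- Every homogeneous set is trivial. -/
def IsPrime : Prop := ∀ A : Set V, G.Homogeneous A → A.Subsingleton ∨ A = Set.univ

/-- No cyclic triangle is blown up from a vertex of a cyclic triangle. -/
def NoBlownTriangle : Prop := ∀ a b c x y, G.Cyc a b c → G.Adj x a → G.Adj x b → G.Adj x c →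
  G.Adj a y → G.Adj b y → G.Adj c y → G.Adj y x → False

/-- Two vertices completing the same edge to a cyclic triangle lie in no common cyclic triangle. -/
def LinkFree : Prop := ∀ a b c d e, G.Cyc a b c → G.Cyc a b d → G.Cyc c d e → False

/-- Every out-neighbourhood and every in-neighbourhood is transitive. -/
def LocallyTransitive : Prop := ∀ a b c x, G.Cyc a b c →
  ¬ (G.Adj x a ∧ G.Adj x b ∧ G.Adj x c) ∧ ¬ (G.Adj a x ∧ G.Adj b x ∧ G.Adj c x)

/-- Reachability between cyclic triangles in `M` that share an edge. -/
inductive Linked (M : Set V) (a b c : V) : V → V → V → Prop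
  | refl : Linked M a b c a b c
  | rot {x y z} : Linked M a b c x y z → Linked M a b c y z x
  | swap {x y z w} : Linked M a b c x y z → w ∈ M → G.Cyc x y w → Linked M a b c x y w

variable {G}

theorem Cyc.rot {a b c : V} (h : G.Cyc a b c) : G.Cyc b c a := ⟨h.2.1, h.2.2, h.1⟩

theorem Linked.trans {M : Set V} {a b c a' b' c' x y z : V} (h : G.Linked M a b c a' b' c')
    (h' : G.Linked M a' b' c' x y z) : G.Linked M a b c x y z := by
  induction h' with
  | refl => exact h
  | rot _ ih => exact ih.rot
  | swap _ hw hc ih => exact ih.swap hw hc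

theorem Linked.cyc {M : Set V} {a b c x y z : V} (h : G.Linked M a b c x y z)
    (ht : G.Cyc a b c) : G.Cyc x y z := by
  induction h with
  | refl => exact ht
  | rot _ ih => exact ih.rot
  | swap _ _ hc _ => exact hc

theorem Linked.mem {M : Set V} {a b c x y z : V} (h : G.Linked M a b c x y z)
    (ht : a ∈ M ∧ b ∈ M ∧ c ∈ M) : x ∈ M ∧ y ∈ M ∧ z ∈ M := by
  induction h with
  | refl => exact ht
  | rot _ ih => exact ⟨ih.2.1, ih.2.2, ih.1⟩
  | swap _ hw _ ih => exact ⟨ih.1, ih.2.1, hw⟩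

theorem Linked.symm {M : Set V} {a b c x y z : V} (h : G.Linked M a b c x y z)
    (ht : G.Cyc a b c) (hm : a ∈ M ∧ b ∈ M ∧ c ∈ M) : G.Linked M x y z a b c := by
  induction h with
  | refl => exact .refl
  | rot _ ih => exact (Linked.refl.rot.rot).trans ih
  | swap h' _ _ ih => exact (Linked.refl.swap (h'.mem hm).2.2 (h'.cyc ht)).trans ih

theorem Linked.mono {M N : Set V} (hMN : M ⊆ N) {a b c x y z : V}
    (h : G.Linked M a b c x y z) : G.Linked N a b c x y z := by
  induction h with
  | refl => exact .refl
  | rot _ ih => exact ih.rot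
  | swap _ hw hc ih => exact ih.swap (hMN hw) hc

/-! ### Blown-up triangles in prime tournaments. -/

theorem NoU5.outside_blown_triangle (h : G.NoU5) {x y p q r s : V} (ht : G.Cyc p q r)
    (hx : G.Adj x p ∧ G.Adj x q ∧ G.Adj x r) (hy : G.Adj p y ∧ G.Adj q y ∧ G.Adj r y)
    (hyx : G.Adj y x) (hs : G.Cyc p q s) : G.Adj x s ∧ G.Adj s y := by
  obtain ⟨h1, h2, h3⟩ := ht
  obtain ⟨-, h5, h6⟩ := hs
  have hsx : s ≠ x := by rintro rfl; exact G.asymm h5 hx.2.1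
  have hsy : s ≠ y := by rintro rfl; exact G.asymm h6 hy.1
  have t1 := G.total hsx
  have t2 := G.total hsy
  have t3 : s = r ∨ G.Adj s r ∨ G.Adj r s := by
    by_cases e : s = r
    · exact Or.inl e
    · exact Or.inr (G.total e)
  have u1 := h y q s r p
  have u2 := h y s x p q
  have u3 := h p x q r s
  have u4 := h s x p q y
  grind

/-- The relation to x and y spreads to all triangles linked to a, b, c. Their vertices form a
homogeneous set, which by primeness is everything and so contains x, making x a neighbour of itself.
-/
theorem NoU5.noBlownTriangle (h : G.NoU5) (hp : G.IsPrime) : G.NoBlownTriangle := by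
  intro a b c x y ht xa xb xc ay b_y cy hyx
  have key : ∀ p q r, G.Linked Set.univ a b c p q r →
      (G.Adj x p ∧ G.Adj x q ∧ G.Adj x r) ∧ (G.Adj p y ∧ G.Adj q y ∧ G.Adj r y) := by
    intro p q r hl
    induction hl with
    | refl => exact ⟨⟨xa, xb, xc⟩, ay, b_y, cy⟩
    | rot _ ih => exact ⟨⟨ih.1.2.1, ih.1.2.2, ih.1.1⟩, ih.2.2.1, ih.2.2.2, ih.2.1⟩
    | swap h' _ hc ih =>
      have := h.outside_blown_triangle (h'.cyc ht) ih.1 ih.2 hyx hc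
      exact ⟨⟨ih.1.1, ih.1.2.1, this.1⟩, ih.2.1, ih.2.2.1, this.2⟩
  let A : Set V := {s | ∃ p q, G.Linked Set.univ a b c s p q}
  have hA : G.Homogeneous A := by
    intro v hv
    -- If v → p and q → v, then p, q, v is a cyclic triangle sharing the edge pq, so v would belong
    -- to A.
    have mix : ∀ p q r, G.Linked Set.univ a b c p q r → ¬ (G.Adj v p ∧ G.Adj q v) ∧ v ≠ p := by
      intro p q r hl
      refine ⟨fun hh => hv ⟨p, q, (hl.swap trivial ⟨(hl.cyc ht).1, hh.2, hh.1⟩).rot.rot⟩, ?_⟩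
      rintro rfl
      exact hv ⟨q, r, hl⟩
    have hom : ∀ p q r, G.Linked Set.univ a b c p q r →
        (G.Adj v p ∧ G.Adj v q ∧ G.Adj v r) ∨ (G.Adj p v ∧ G.Adj q v ∧ G.Adj r v) := by
      intro p q r hl
      have m1 := mix _ _ _ hl
      have m2 := mix _ _ _ hl.rot
      have m3 := mix _ _ _ hl.rot.rot
      have t1 := G.total m1.2
      have t2 := G.total m2.2
      have t3 := G.total m3.2
      tauto
    have hom' : ∀ p q r, G.Linked Set.univ a b c p q r → (G.Adj v p ↔ G.Adj v a) := by
      intro p q r hl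
      have : (G.Adj v p ↔ G.Adj v a) ∧ (G.Adj v q ↔ G.Adj v a) := by
        induction hl with
        | refl =>
          have := hom _ _ _ .refl
          have := @asymm V G v
          grind
        | rot h' ih =>
          have := hom _ _ _ h'
          have := @asymm V G v
          grind
        | swap _ _ _ ih => exact ih
      exact this.1
    by_cases hva : G.Adj v a
    · exact Or.inl fun s ⟨p, q, hl⟩ => (hom' _ _ _ hl).2 hva
    · refine Or.inr fun s ⟨p, q, hl⟩ => ?_
      have := hom _ _ _ hl
      have := hom' _ _ _ hl
      tauto
  rcases hp A hA with h1 | h1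
  · exact G.ne_of_adj ht.1 (h1 ⟨b, c, .refl⟩ ⟨c, a, Linked.refl.rot⟩)
  · obtain ⟨p, q, hl⟩ : x ∈ A := h1 ▸ trivial
    exact G.loopless x (key _ _ _ hl).1.1

/-- The four possible directions between e and a, b produce U₅ twice, a blown-up triangle once, and
the regular five-vertex tournament once. -/
theorem NoU5.linkFree (h : G.NoU5) (hb : G.NoBlownTriangle)
    (hq : ∀ a b c d e, ¬ G.Pent a b c d e) : G.LinkFree := by
  rintro a b c d e ⟨ab, bc, ca⟩ ⟨-, bd, da⟩ ⟨cd, de, ec⟩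
  have hea : e ≠ a := by rintro rfl; exact G.asymm ca ec
  have heb : e ≠ b := by rintro rfl; exact G.asymm bd de
  rcases G.total hea with h1 | h1 <;> rcases G.total heb with h2 | h2
  · exact h a e b c d h1 ab h2 ec bc bd cd ca da de
  · exact hb c d e b a ⟨cd, de, ec⟩ bc bd h2 ca da h1 ab
  · exact hq a e b c d ⟨h1, ab, h2, ec, bc, bd, cd, ca, da, de⟩
  · exact h e b c d a h2 ec bc bd cd ca da de h1 ab

/-! ### Regular five-vertex subtournaments and local transitivity. -/

theorem Pent.rot {a b c d e : V} (h : G.Pent a b c d e) : G.Pent b c d e a := by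
  unfold Pent at *; tauto

/-- Of the 32 adjacency patterns of v, two are constant, ten let v replace a vertex (whose edge to v
is then free), and the other twenty contain U₅. -/
theorem NoU5.pent (h : G.NoU5) {a b c d e v : V} (hq : G.Pent a b c d e)
    (hv : v ≠ a ∧ v ≠ b ∧ v ≠ c ∧ v ≠ d ∧ v ≠ e) :
    (G.Adj v a ∧ G.Adj v b ∧ G.Adj v c ∧ G.Adj v d ∧ G.Adj v e) ∨
    (G.Adj a v ∧ G.Adj b v ∧ G.Adj c v ∧ G.Adj d v ∧ G.Adj e v) ∨
    G.Pent v b c d e ∨ G.Pent a v c d e ∨ G.Pent a b v d e ∨ G.Pent a b c v e ∨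
    G.Pent a b c d v := by
  obtain ⟨ab, ac, bc, bd, cd, ce, de, da, ea, eb⟩ := hq
  obtain ⟨va, vb, vc, vd, ve⟩ := hv
  rcases G.total va with va | va <;> rcases G.total vb with vb | vb <;>
  rcases G.total vc with vc | vc <;> rcases G.total vd with vd | vd <;>
  rcases G.total ve with ve | ve
  · exact Or.inl ⟨va, vb, vc, vd, ve⟩
  · exact (h a v c d e va ac vc vd cd ce de da ea ve).elim
  · exact (h e v b c d ve eb vb vc bc bd cd ce de vd).elim
  · exact Or.inr (Or.inr (Or.inl ⟨vb, vc, bc, bd, cd, ce, de, vd, ve, eb⟩))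
  · exact (h d v a b c vd da va vb ab ac bc bd cd vc).elim
  · exact (h d c e v b cd de ce vc ve eb vb vd bd bc).elim
  · exact Or.inr (Or.inr (Or.inr (Or.inr (Or.inr (Or.inr (⟨ab, ac, bc, bd, cd, vc, vd, da, va, vb⟩))))))
  · exact Or.inr (Or.inr (Or.inr (Or.inr (Or.inr (Or.inr (⟨ab, ac, bc, bd, cd, vc, vd, da, va, vb⟩))))))
  · exact (h c v e a b vc ce ve va ea eb ab ac bc vb).elim
  · exact (h a e b v d ea ab eb ve vb bd vd va da de).elim
  · exact (h c b d v a bc cd bd vb vd da va vc ac ab).elim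
  · exact (h c b d v a bc cd bd vb vd da va vc ac ab).elim
  · exact Or.inr (Or.inr (Or.inr (Or.inr (Or.inr (Or.inl ⟨ab, ac, bc, vb, vc, ce, ve, va, ea, eb⟩)))))
  · exact (h a e b v d ea ab eb ve vb bd vd va da de).elim
  · exact Or.inr (Or.inr (Or.inr (Or.inr (Or.inr (Or.inl ⟨ab, ac, bc, vb, vc, ce, ve, va, ea, eb⟩)))))
  · exact (h v e a b c ve va ea eb ab ac bc vb vc ce).elim
  · exact (h b v d e a vb bd vd ve de da ea eb ab va).elim
  · exact Or.inr (Or.inr (Or.inr (Or.inl ⟨va, ac, vc, vd, cd, ce, de, da, ea, ve⟩)))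
  · exact (h e d a v c de ea da vd va ac vc ve ce cd).elim
  · exact Or.inr (Or.inr (Or.inl ⟨vb, vc, bc, bd, cd, ce, de, vd, ve, eb⟩))
  · exact (h b a c v e ab bc ac va vc ce ve vb eb ea).elim
  · exact (h d c e v b cd de ce vc ve eb vb vd bd bc).elim
  · exact (h b a c v e ab bc ac va vc ce ve vb eb ea).elim
  · exact (h v a b c d va vb ab ac bc bd cd vc vd da).elim
  · exact Or.inr (Or.inr (Or.inr (Or.inr (Or.inl ⟨ab, va, vb, bd, vd, ve, de, da, ea, eb⟩))))
  · exact Or.inr (Or.inr (Or.inr (Or.inl ⟨va, ac, vc, vd, cd, ce, de, da, ea, ve⟩)))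
  · exact (h e d a v c de ea da vd va ac vc ve ce cd).elim
  · exact (h v b c d e vb vc bc bd cd ce de vd ve eb).elim
  · exact Or.inr (Or.inr (Or.inr (Or.inr (Or.inl ⟨ab, va, vb, bd, vd, ve, de, da, ea, eb⟩))))
  · exact (h v c d e a vc vd cd ce de da ea ve va ac).elim
  · exact (h v d e a b vd ve de da ea eb ab va vb bd).elim
  · exact Or.inr (Or.inl ⟨va, vb, vc, vd, ve⟩)

/-- Reachability between regular five-vertex subtournaments by exchanging one vertex at a time. -/
inductive PentLinked (G : Tournament V) (a b c d e : V) : V → V → V → V → V → Prop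
  | refl : PentLinked G a b c d e a b c d e
  | rot {x y z w t} : PentLinked G a b c d e x y z w t → PentLinked G a b c d e y z w t x
  | swap {x y z w t s} : PentLinked G a b c d e x y z w t → G.Pent s y z w t →
      PentLinked G a b c d e s y z w t

theorem PentLinked.pent {a b c d e x y z w t : V} (h : G.PentLinked a b c d e x y z w t)
    (hq : G.Pent a b c d e) : G.Pent x y z w t := by
  induction h with
  | refl => exact hq
  | rot _ ih => exact ih.rot
  | swap _ hc _ => exact hc

/-- A vertex dominating four of the five vertices cannot replace any of them, since a replacement
needs two in-neighbours among the remaining four; nor can it replace the fifth. Hence `NoU5.pent`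
makes it dominate the fifth too. -/
theorem PentLinked.const (hU : G.NoU5) {a b c d e x y z w t v : V}
    (h : G.PentLinked a b c d e x y z w t)
    (ha : G.Adj v a ∧ G.Adj v b ∧ G.Adj v c ∧ G.Adj v d ∧ G.Adj v e) :
    G.Adj v x ∧ G.Adj v y ∧ G.Adj v z ∧ G.Adj v w ∧ G.Adj v t := by
  induction h with
  | refl => exact ha
  | rot _ ih => exact ⟨ih.2.1, ih.2.2.1, ih.2.2.2.1, ih.2.2.2.2, ih.1⟩
  | @swap x y z w t s h' hc ih =>
    obtain ⟨-, h2, h3, h4, h5⟩ := ih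
    have hs : v ≠ s := by
      rintro rfl
      exact G.asymm h4 hc.2.2.2.2.2.2.2.1
    have := hU.pent hc ⟨hs, G.ne_of_adj h2, G.ne_of_adj h3, G.ne_of_adj h4, G.ne_of_adj h5⟩
    have as := @asymm V G v
    unfold Pent at this
    grind

theorem PentLinked.const' (hU : G.NoU5) {a b c d e x y z w t v : V}
    (h : G.PentLinked a b c d e x y z w t)
    (ha : G.Adj a v ∧ G.Adj b v ∧ G.Adj c v ∧ G.Adj d v ∧ G.Adj e v) :
    G.Adj x v ∧ G.Adj y v ∧ G.Adj z v ∧ G.Adj w v ∧ G.Adj t v := by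
  induction h with
  | refl => exact ha
  | rot _ ih => exact ⟨ih.2.1, ih.2.2.1, ih.2.2.2.1, ih.2.2.2.2, ih.1⟩
  | @swap x y z w t s h' hc ih =>
    obtain ⟨-, h2, h3, h4, h5⟩ := ih
    have hs : v ≠ s := by
      rintro rfl
      exact G.asymm h2 (hc.1)
    have := hU.pent hc ⟨hs, (G.ne_of_adj h2).symm, (G.ne_of_adj h3).symm, (G.ne_of_adj h4).symm,
      (G.ne_of_adj h5).symm⟩
    have as := fun y => @asymm V G y v
    unfold Pent at this
    grind

/-- In a prime `U₅`-free tournament, the linked copies of `T₅` cover all vertices. -/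
theorem NoU5.exists_pentLinked (hU : G.NoU5) (hp : G.IsPrime) {a b c d e : V}
    (hq : G.Pent a b c d e) (v : V) : ∃ y z w t, G.PentLinked a b c d e v y z w t := by
  let A : Set V := {v | ∃ y z w t, G.PentLinked a b c d e v y z w t}
  have hA : G.Homogeneous A := by
    intro v hv
    have hne : ∀ x y z w t, G.PentLinked a b c d e x y z w t → v ≠ x := by
      rintro x y z w t h rfl
      exact hv ⟨_, _, _, _, h⟩
    have l : G.PentLinked a b c d e a b c d e := .refl
    have key := hU.pent hq ⟨hne _ _ _ _ _ l, hne _ _ _ _ _ l.rot, hne _ _ _ _ _ l.rot.rot,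
      hne _ _ _ _ _ l.rot.rot.rot, hne _ _ _ _ _ l.rot.rot.rot.rot⟩
    rcases key with h | h | h | h | h | h | h
    · exact Or.inl fun x ⟨_, _, _, _, hl⟩ => (hl.const hU h).1
    · exact Or.inr fun x ⟨_, _, _, _, hl⟩ => (hl.const' hU h).1
    · exact absurd rfl (hne _ _ _ _ _ (l.swap h))
    · exact absurd rfl (hne _ _ _ _ _ (l.rot.swap h.rot))
    · exact absurd rfl (hne _ _ _ _ _ (l.rot.rot.swap h.rot.rot))
    · exact absurd rfl (hne _ _ _ _ _ (l.rot.rot.rot.swap h.rot.rot.rot))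
    · exact absurd rfl (hne _ _ _ _ _ (l.rot.rot.rot.rot.swap h.rot.rot.rot.rot))
  rcases hp A hA with h1 | h1
  · exact absurd (h1 ⟨_, _, _, _, .refl⟩ ⟨_, _, _, _, PentLinked.refl.rot⟩) (G.ne_of_adj hq.1)
  · exact (h1 ▸ Set.mem_univ v : v ∈ A)

/-- In a prime `U₅`-free tournament, every vertex outside of a copy of `T₅` can be exchanged with
one of its vertices. -/
theorem NoU5.pent_of_isPrime (hU : G.NoU5) (hp : G.IsPrime) {a b c d e v : V}
    (hq : G.Pent a b c d e) (hv : v ≠ a ∧ v ≠ b ∧ v ≠ c ∧ v ≠ d ∧ v ≠ e) :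
    G.Pent v b c d e ∨ G.Pent a v c d e ∨ G.Pent a b v d e ∨ G.Pent a b c v e ∨
    G.Pent a b c d v := by
  obtain ⟨_, _, _, _, hl⟩ := hU.exists_pentLinked hp hq v
  rcases hU.pent hq hv with h | h | h
  · exact absurd (hl.const hU h).1 (G.loopless v)
  · exact absurd (hl.const' hU h).1 (G.loopless v)
  · exact h

/-- Two members of a cyclic triangle dominated by `x` are not at the first position after `x`. -/
theorem NoU5.not_dominates_fst (hU : G.NoU5) (hp : G.IsPrime) {x a b c p q r : V}
    (ht : G.Cyc a b c) (hx : G.Adj x a ∧ G.Adj x b ∧ G.Adj x c) (hq : G.Pent x a p q r) :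
    False := by
  have hD := hU.noBlownTriangle hp
  have as := @asymm V G
  have irr := G.loopless
  -- If a and b were the two out-neighbours of x in the five-set, c could replace none of the five
  -- vertices.
  have two : ∀ {b c q r : V}, G.Cyc a b c → G.Adj x b → G.Adj x c → ¬ G.Pent x a b q r := by
    intro b c q r ht xb xc hq
    have := @NoU5.pent_of_isPrime V G hU hp x a b q r c hq
    simp only [Pent, Cyc] at *
    grind
  by_cases hbp : b = p
  · subst hbp
    exact two ht hx.2.1 hx.2.2 hq
  have hb : G.Pent x b p q r := by
    rcases hU.pent_of_isPrime hp hq (v := b)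
      (by simp only [Pent, Cyc] at hq ht; grind) with h | h | h | h | h
    · exact absurd h.1 (G.asymm ht.1)
    · exact h
    · exact (two ht hx.2.1 hx.2.2 h).elim
    · exact absurd h.2.2.2.2.2.2.2.1 (G.asymm hx.2.1)
    · exact absurd h.2.2.2.2.2.2.2.2.1 (G.asymm hx.2.1)
  rcases hU.pent_of_isPrime hp hq (v := c)
      (by simp only [Pent, Cyc] at hq ht; grind) with h | h | h | h | h
  · have := @NoU5.pent V G hU c a p q r b h
    simp only [Pent, Cyc] at *
    grind
  · have := hD a b c r p ht
    simp only [Pent, Cyc] at *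
    grind
  · exact absurd h.2.2.1 (G.asymm ht.2.2)
  · exact absurd h.2.2.2.2.2.2.2.1 (G.asymm hx.2.2)
  · exact absurd h.2.2.2.2.2.2.2.2.1 (G.asymm hx.2.2)

/-- Here b must replace a. If c also does, then x, the triangle and q form a blown-up triangle; if c
replaces p, `NoU5.not_dominates_fst` applies; if c replaces x, two further exchanges fail. -/
theorem NoU5.not_dominates_snd (hU : G.NoU5) (hp : G.IsPrime) {x a b c p q r : V}
    (ht : G.Cyc a b c) (hx : G.Adj x a ∧ G.Adj x b ∧ G.Adj x c) (hq : G.Pent x p a q r) :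
    False := by
  have hD := hU.noBlownTriangle hp
  have as := @asymm V G
  have irr := G.loopless
  have hbp : b ≠ p := by
    rintro rfl
    exact as ht.1 hq.2.2.1
  have hb : G.Pent x p b q r := by
    rcases hU.pent_of_isPrime hp hq (v := b)
      (by simp only [Pent, Cyc] at hq ht; grind) with h | h | h | h | h
    · exact absurd h.2.1 (G.asymm ht.1)
    · exact absurd h.2.2.1 (G.asymm ht.1)
    · exact h
    · exact absurd h.2.2.2.2.2.2.2.1 (G.asymm hx.2.1)
    · exact absurd h.2.2.2.2.2.2.2.2.1 (G.asymm hx.2.1)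
  have hcp : c ≠ p := by
    rintro rfl
    exact as ht.2.1 hb.2.2.1
  rcases hU.pent_of_isPrime hp hq (v := c)
      (by simp only [Pent, Cyc] at hq ht; grind) with h | h | h | h | h
  · have h1 : G.Pent c p a b r := by
      have := @NoU5.pent V G hU c p a q r b h
      simp only [Pent, Cyc] at *
      grind
    have := @NoU5.pent V G hU c p a b r x h1
    simp only [Pent, Cyc] at *
    grind
  · exact hU.not_dominates_fst hp ht.rot.rot ⟨hx.2.2, hx.1, hx.2.1⟩ h
  · have := hD a b c x q ht
    simp only [Pent, Cyc] at *
    grind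
  · exact absurd h.2.2.2.2.2.2.2.1 (G.asymm hx.2.2)
  · exact absurd h.2.2.2.2.2.2.2.2.1 (G.asymm hx.2.2)

/-- With both out-positions excluded, each of a, b, c can only replace x itself; then r, the
triangle and p form a blown-up triangle. -/
theorem NoU5.not_dominates (hU : G.NoU5) (hp : G.IsPrime) {x a b c p q r s : V}
    (ht : G.Cyc a b c) (hx : G.Adj x a ∧ G.Adj x b ∧ G.Adj x c) (hq : G.Pent x p q r s) :
    False := by
  have step : ∀ {a b c}, G.Cyc a b c → (G.Adj x a ∧ G.Adj x b ∧ G.Adj x c) →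
      G.Pent a p q r s := by
    intro a b c ht hx
    by_cases h1 : a = p
    · subst h1
      exact (hU.not_dominates_fst hp ht hx hq).elim
    by_cases h2 : a = q
    · subst h2
      exact (hU.not_dominates_snd hp ht hx hq).elim
    have as := @asymm V G
    have irr := G.loopless
    rcases hU.pent_of_isPrime hp hq (v := a)
      (by simp only [Pent, Cyc] at hq ht; grind) with h | h | h | h | h
    · exact h
    · exact (hU.not_dominates_fst hp ht hx h).elim
    · exact (hU.not_dominates_snd hp ht hx h).elim
    · exact absurd h.2.2.2.2.2.2.2.1 (G.asymm hx.1)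
    · exact absurd h.2.2.2.2.2.2.2.2.1 (G.asymm hx.1)
  have ha := step ht hx
  have hb := step ht.rot ⟨hx.2.1, hx.2.2, hx.1⟩
  have hc := step ht.rot.rot ⟨hx.2.2, hx.1, hx.2.1⟩
  have := hU.noBlownTriangle hp a b c r p ht
  simp only [Pent, Cyc] at *
  grind

theorem NoU5.reverse (hU : G.NoU5) : G.reverse.NoU5 := by
  intro a b c d e h1 h2 h3 h4 h5 h6 h7 h8 h9 h10
  simp only [Tournament.reverse] at *
  -- U₅ is isomorphic to its reverse by exchanging v₁ with v₂ and v₃ with v₅.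
  exact hU b a e d c h1 h10 h9 h8 h7 h6 h5 h4 h3 h2

theorem IsPrime.reverse (hp : G.IsPrime) : G.reverse.IsPrime :=
  fun A hA => hp A fun v hv => (hA v hv).symm

theorem Pent.reverse {a b c d e : V} (h : G.Pent a b c d e) : G.reverse.Pent e d c b a := by
  simp only [Pent, Tournament.reverse] at *
  tauto

/-- A prime `U₅`-free tournament containing `T₅` is locally transitive. -/
theorem NoU5.locallyTransitive (hU : G.NoU5) (hp : G.IsPrime) {a b c d e : V}
    (hq : G.Pent a b c d e) : G.LocallyTransitive := by
  intro p q r x ht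
  constructor
  · intro hx
    obtain ⟨_, _, _, _, hl⟩ := hU.exists_pentLinked hp hq x
    exact hU.not_dominates hp ht hx (hl.pent hq)
  · intro hx
    obtain ⟨_, _, _, _, hl⟩ := hU.reverse.exists_pentLinked hp.reverse hq.reverse x
    exact hU.reverse.not_dominates hp.reverse (a := r) (b := q) (c := p)
      ⟨ht.2.1, ht.1, ht.2.2⟩ ⟨hx.2.2, hx.2.1, hx.1⟩ (hl.pent hq.reverse)

/-! ### Twins in locally transitive tournaments. -/

theorem exists_last [Finite V] (S : Set V) (hS : S.Nonempty)
    (hT : ∀ a ∈ S, ∀ b ∈ S, ∀ c ∈ S, ¬ G.Cyc a b c) : ∃ a ∈ S, ∀ x ∈ S, x ≠ a → G.Adj x a := by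
  let r : S → S → Prop := fun x y => G.Adj y x
  have : IsTrans S r := ⟨fun x y z h1 h2 => by
    have hne : z ≠ x := by
      rintro rfl
      exact G.asymm h1 h2
    rcases G.total (fun e => hne (Subtype.ext e)) with h | h
    · exact h
    · exact (hT _ z.2 _ y.2 _ x.2 ⟨h2, h1, h⟩).elim⟩
  have : Std.Irrefl r := ⟨fun x => G.loopless x⟩
  obtain ⟨a, -, ha⟩ := (Finite.wellFounded_of_trans_of_irrefl r).has_min Set.univ
    ⟨⟨hS.some, hS.some_mem⟩, trivial⟩
  refine ⟨a, a.2, fun x hx hxa => ?_⟩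
  rcases G.total hxa with h | h
  · exact h
  · exact (ha ⟨x, hx⟩ trivial h).elim

/-- A vertex off the triangle has both an out- and an in-neighbour on it, so along some edge of the
triangle it passes from out to in. -/
theorem LocallyTransitive.exists_cyc (hL : G.LocallyTransitive) {p q r : V} (ht : G.Cyc p q r)
    (u : V) : ∃ a b, G.Cyc u a b := by
  by_cases h1 : u = p
  · exact ⟨q, r, h1 ▸ ht⟩
  by_cases h2 : u = q
  · exact ⟨r, p, h2 ▸ ht.rot⟩
  by_cases h3 : u = r
  · exact ⟨p, q, h3 ▸ ht.rot.rot⟩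
  have := hL p q r u ht
  have t1 := G.total h1
  have t2 := G.total h2
  have t3 := G.total h3
  have e1 : G.Adj u p → G.Adj q u → ∃ a b, G.Cyc u a b := fun x y => ⟨p, q, x, ht.1, y⟩
  have e2 : G.Adj u q → G.Adj r u → ∃ a b, G.Cyc u a b := fun x y => ⟨q, r, x, ht.2.1, y⟩
  have e3 : G.Adj u r → G.Adj p u → ∃ a b, G.Cyc u a b := fun x y => ⟨r, p, x, ht.2.2, y⟩
  rcases t1 with t1 | t1 <;> rcases t2 with t2 | t2 <;> rcases t3 with t3 | t3
  · exact (this.1 ⟨t1, t2, t3⟩).elim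
  · exact e2 t2 t3
  · exact e1 t1 t2
  · exact e1 t1 t2
  · exact e3 t3 t1
  · exact e2 t2 t3
  · exact e3 t3 t1
  · exact (this.2 ⟨t1, t2, t3⟩).elim

/-- After deleting any vertex, a prime locally transitive tournament has a pair of twins. -/
theorem LocallyTransitive.exists_twins [Finite V] (hL : G.LocallyTransitive) (hp : G.IsPrime)
    {p q r : V} (ht : G.Cyc p q r) (u : V) :
    ∃ a b, a ≠ u ∧ b ≠ u ∧ G.Adj a b ∧ ∀ x, x ≠ u → x ≠ a → x ≠ b → (G.Adj x a ↔ G.Adj x b) := by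
  obtain ⟨a', b', ua', ab', bu'⟩ := hL.exists_cyc ht u
  -- The twins are the last out-neighbour a and the first in-neighbour b of u.
  obtain ⟨a, ua, ha⟩ := G.exists_last {x | G.Adj u x} ⟨a', ua'⟩
    fun x hx y hy z hz h => (hL x y z u h).1 ⟨hx, hy, hz⟩
  obtain ⟨b, bu, hb⟩ := G.reverse.exists_last {x | G.Adj x u} ⟨b', bu'⟩
    fun x hx y hy z hz h => (hL z y x u ⟨h.2.1, h.1, h.2.2⟩).2 ⟨hz, hy, hx⟩
  simp only [Set.mem_ofPred_eq, Tournament.reverse] at ua ha bu hb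
  have as := @asymm V G
  have irr := G.loopless
  have tot := @total V G
  have hab : G.Adj a b := by
    by_contra hab
    have hne : a ≠ b := by rintro rfl; exact as ua bu
    have hba : G.Adj b a := (tot hne).resolve_left hab
    have h1 : G.Adj a' b := by
      by_contra h
      have h2 : b' ≠ b := by rintro rfl; exact h ab'
      have h3 : a' ≠ b := by rintro rfl; exact as ua' bu
      exact (hL u a' b' b ⟨ua', ab', bu'⟩).1 ⟨bu, (tot h3).resolve_left h, hb _ bu' h2⟩
    have h2 : a' ≠ a := by rintro rfl; exact hab h1
    exact (hL u a' b a ⟨ua', h1, bu⟩).2 ⟨ua, ha _ ua' h2, hba⟩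
  have hbet : ∀ y, ¬ (G.Adj a y ∧ G.Adj y b) := by
    rintro y ⟨h1, h2⟩
    have hyu : y ≠ u := by rintro rfl; exact as ua h1
    rcases tot hyu with h | h
    · exact as h2 (hb y h (G.ne_of_adj h2))
    · exact as h1 (ha y h (G.ne_of_adj h1).symm)
  -- Since no vertex lies between a and b, these are the only vertices outside {a, b} that
  -- distinguish them. The set is homogeneous, and primeness shrinks it to {u}.
  let D : Set V := {x | G.Adj b x ∧ G.Adj x a}
  have hD : G.Homogeneous D := by
    intro y hy
    by_contra hcon
    push Not at hcon
    obtain ⟨⟨d, hd, hyd⟩, ⟨d', hd', hdy'⟩⟩ := hcon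
    have n1 : y ≠ d := by rintro rfl; exact hy hd
    have n2 : y ≠ d' := by rintro rfl; exact hy hd'
    have dy := (tot n1).resolve_left hyd
    have yd := (tot n2).resolve_right hdy'
    have hdd : d ≠ d' := by rintro rfl; exact as dy yd
    have hya : y ≠ a := by rintro rfl; exact as yd hd'.2
    have hyb : y ≠ b := by rintro rfl; exact as dy hd.1
    by_cases h1 : G.Adj a y
    · have by' := (tot hyb).resolve_left fun h => hbet y ⟨h1, h⟩
      rcases tot hdd with h | h
      · exact (hL a y d' d ⟨h1, yd, hd'.2⟩).1 ⟨hd.2, dy, h⟩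
      · exact (hL d' d y b ⟨h, dy, yd⟩).1 ⟨hd'.1, hd.1, by'⟩
    · have ya := (tot hya).resolve_right h1
      have yb := (tot hyb).resolve_right fun h => hy ⟨h, ya⟩
      rcases tot hdd with h | h
      · exact (hL b d y d' ⟨hd.1, dy, yb⟩).2 ⟨hd'.1, h, yd⟩
      · exact (hL d' d y a ⟨h, dy, yd⟩).2 ⟨hd'.2, hd.2, ya⟩
  have hu : u ∈ D := ⟨bu, ua⟩
  have hDu : D = {u} := by
    rcases hp D hD with h | h
    · exact h.eq_singleton_of_mem hu
    · exact (irr a (h ▸ Set.mem_univ a : a ∈ D).2).elim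
  refine ⟨a, b, (G.ne_of_adj ua).symm, G.ne_of_adj bu, hab, fun x hxu hxa hxb => ?_⟩
  have h1 : ¬ (G.Adj b x ∧ G.Adj x a) := fun h => hxu (by
    have : x ∈ D := h
    rwa [hDu] at this)
  have := hbet x
  have := tot hxa
  have := tot hxb
  have := @as x a
  have := @as x b
  tauto

/-! ### Cyclic colourings of link-free tournaments. -/

/-- A map to `ZMod 3` which increases by one along the edges of cyclic triangles in `M`. -/
def CyclicColoring (G : Tournament V) (M : Set V) (φ : V → ZMod 3) : Prop :=
  ∀ a ∈ M, ∀ b ∈ M, ∀ c ∈ M, G.Cyc a b c → φ b = φ a + 1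

theorem CyclicColoring.reverse {M : Set V} {φ : V → ZMod 3} (h : G.CyclicColoring M φ) :
    G.reverse.CyclicColoring M (-φ) := by
  intro a ha b hb c hc ht
  have := h b hb a ha c hc ⟨ht.1, ht.2.2, ht.2.1⟩
  simp only [Pi.neg_apply, this]
  ring

theorem LinkFree.reverse (h : G.LinkFree) : G.reverse.LinkFree := by
  intro a b c d e h1 h2 h3
  exact h b a d c e ⟨h2.1, h2.2.2, h2.2.1⟩ ⟨h1.1, h1.2.2, h1.2.1⟩ ⟨h3.1, h3.2.2, h3.2.1⟩

/-- Any two cyclic triangles at a vertex are joined by an edge of one of two kinds. -/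
theorem LinkFree.adj_or_adj (h : G.LinkFree) {v a b x y : V} (h1 : G.Cyc v a b)
    (h2 : G.Cyc v x y) : G.Adj a y ∨ G.Adj x b := by
  by_contra hcon
  push Not at hcon
  have hay : a ≠ y := by rintro rfl; exact G.asymm h1.1 h2.2.2
  have hxb : x ≠ b := by rintro rfl; exact G.asymm h2.1 h1.2.2
  have ya := (G.total hay).resolve_left hcon.1
  have bx := (G.total hxb).resolve_left hcon.2
  have hax : a ≠ x := by rintro rfl; exact hcon.1 h2.2.1
  rcases G.total hax with ax | xa
  · exact h x y v a b h2.rot ⟨h2.2.1, ya, ax⟩ h1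
  · exact h a b v x y h1.rot ⟨h1.2.1, bx, xa⟩ h2

/-- By `LinkFree.adj_or_adj`, one of v, a, y and v, x, b is a cyclic triangle, and it shares an edge
with each of the two given ones. -/
theorem LinkFree.linked (h : G.LinkFree) {M : Set V} {v a b x y : V}
    (hx : x ∈ M) (hy : y ∈ M)
    (h1 : G.Cyc v a b) (h2 : G.Cyc v x y) : G.Linked M v a b v x y := by
  rcases h.adj_or_adj h1 h2 with h3 | h3
  · exact ((Linked.refl.swap hy ⟨h1.1, h3, h2.2.2⟩).rot.rot.swap hx h2.rot.rot).rot
  · exact (Linked.refl.rot.rot.swap hx ⟨h1.2.2, h2.1, h3⟩).rot.swap hy h2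

/-- A colour that a triangle dominated by `v` forces on `v`. -/
def OutKey (G : Tournament V) (M : Set V) (φ : V → ZMod 3) (v : V) (κ : ZMod 3) : Prop :=
  ∃ a ∈ M, ∃ b ∈ M, ∃ c ∈ M, ∃ w ∈ M, G.Cyc a b c ∧ G.Adj v a ∧ G.Adj v b ∧ G.Adj v c ∧
    G.Adj a w ∧ G.Adj w v ∧ φ a = κ

/-- A colour that a triangle dominating `v` forces on `v`. -/
def InKey (G : Tournament V) (M : Set V) (φ : V → ZMod 3) (v : V) (κ : ZMod 3) : Prop :=
  ∃ a ∈ M, ∃ b ∈ M, ∃ c ∈ M, ∃ w ∈ M, G.Cyc a b c ∧ G.Adj a v ∧ G.Adj b v ∧ G.Adj c v ∧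
    G.Adj w a ∧ G.Adj v w ∧ φ a = κ + 1

/-- If c → w, then a and c both complete w → v to a cyclic triangle while lying in a common one. So
w → c, and a, w, c is a coloured cyclic triangle. -/
theorem LinkFree.color_succ (h : G.LinkFree) {M : Set V} {φ : V → ZMod 3}
    (hφ : G.CyclicColoring M φ) {v a b c w : V} (ha : a ∈ M) (hc : c ∈ M)
    (hw : w ∈ M) (ht : G.Cyc a b c) (va : G.Adj v a) (vc : G.Adj v c)
    (aw : G.Adj a w) (wv : G.Adj w v) : φ w = φ a + 1 := by
  have hwc : w ≠ c := by rintro rfl; exact G.asymm vc wv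
  rcases G.total hwc with h1 | h1
  · exact hφ a ha w hw c hc ⟨aw, h1, ht.2.2⟩
  · exact (h w v c a b ⟨wv, vc, h1⟩ ⟨wv, va, aw⟩ ht.rot.rot).elim

/-- By `LinkFree.adj_or_adj`, one of the two witnesses w, w' also serves the other triangle, and
`LinkFree.color_succ` then computes its colour in two ways. -/
theorem OutKey.unique (h : G.LinkFree) {M : Set V} {φ : V → ZMod 3}
    (hφ : G.CyclicColoring M φ) {v : V} {κ κ' : ZMod 3} (h1 : G.OutKey M φ v κ)
    (h2 : G.OutKey M φ v κ') : κ = κ' := by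
  obtain ⟨a, ha, b, hb, c, hc, w, hw, ht, va, vb, vc, aw, wv, rfl⟩ := h1
  obtain ⟨a', ha', b', hb', c', hc', w', hw', ht', va', vb', vc', aw', wv', rfl⟩ := h2
  have e1 := h.color_succ hφ ha hc hw ht va vc aw wv
  have e2 := h.color_succ hφ ha' hc' hw' ht' va' vc' aw' wv'
  rcases h.adj_or_adj ⟨va, aw, wv⟩ ⟨va', aw', wv'⟩ with h3 | h3
  · have e3 := h.color_succ hφ ha hc hw' ht va vc h3 wv'
    exact add_right_cancel (e3.symm.trans e2)
  · have e3 := h.color_succ hφ ha' hc' hw ht' va' vc' h3 wv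
    exact add_right_cancel (e1.symm.trans e3)

theorem InKey.reverse {M : Set V} {φ : V → ZMod 3} {v : V} {κ : ZMod 3}
    (h : G.InKey M φ v κ) : G.reverse.OutKey M (-φ) v (-κ - 1) := by
  obtain ⟨a, ha, b, hb, c, hc, w, hw, ht, va, vb, vc, aw, wv, e⟩ := h
  refine ⟨a, ha, c, hc, b, hb, w, hw, ⟨ht.2.2, ht.2.1, ht.1⟩, va, vc, vb, aw, wv, ?_⟩
  simp only [Pi.neg_apply, e]
  ring

theorem InKey.unique (h : G.LinkFree) {M : Set V} {φ : V → ZMod 3}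
    (hφ : G.CyclicColoring M φ) {v : V} {κ κ' : ZMod 3} (h1 : G.InKey M φ v κ)
    (h2 : G.InKey M φ v κ') : κ = κ' := by
  have := h1.reverse.unique h.reverse hφ.reverse h2.reverse
  exact neg_injective (sub_left_injective this)

/-- The triangle `x → y → z → x` is compatible with `v` getting the colour `κ - 1`. -/
def Compatible (G : Tournament V) (M : Set V) (φ : V → ZMod 3) (v : V) (κ : ZMod 3)
    (x y z : V) : Prop :=
  (G.Adj v x → G.Adj y v → φ x = κ) ∧ (G.Adj v y → G.Adj z v → φ y = κ) ∧
  (G.Adj v z → G.Adj x v → φ z = κ) ∧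
  (G.Adj v x → G.Adj v y → G.Adj v z → G.OutKey M φ v κ) ∧
  (G.Adj x v → G.Adj y v → G.Adj z v → G.InKey M φ v κ)

/-- The vertices z and w have the same colour, so only the cases where v separates them matter.
There the other vertex witnesses a key, which is unique, or link-freeness fails. -/
theorem LinkFree.compatible_swap (h : G.LinkFree) {M : Set V} {φ : V → ZMod 3}
    (hφ : G.CyclicColoring M φ) {v : V} (hv : v ∉ M) {κ : ZMod 3} {x y z w : V}
    (hx : x ∈ M) (hy : y ∈ M) (hz : z ∈ M) (hw : w ∈ M) (h1 : G.Cyc x y z) (h2 : G.Cyc x y w)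
    (hc : G.Compatible M φ v κ x y z) : G.Compatible M φ v κ x y w := by
  have tot : ∀ {x}, x ∈ M → G.Adj v x ∨ G.Adj x v := fun hx => G.total (by
    rintro rfl; exact hv hx)
  have as := @asymm V G v
  have c1 : φ y = φ x + 1 := hφ _ hx _ hy _ hz h1
  have c2 : φ x = φ z + 1 := hφ _ hz _ hx _ hy h1.rot.rot
  have c3 : φ z = φ w := add_right_cancel (c2.symm.trans (hφ _ hw _ hx _ hy h2.rot.rot))
  have p1 : G.Adj v x → G.Adj v y → G.Adj v z → G.Adj w v → G.OutKey M φ v (φ y) :=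
    fun a b c d => ⟨y, hy, z, hz, x, hx, w, hw, h1.rot, b, c, a, h2.2.1, d, rfl⟩
  have p2 : G.Adj v x → G.Adj v y → G.Adj v w → G.Adj z v → G.OutKey M φ v (φ y) :=
    fun a b c d => ⟨y, hy, w, hw, x, hx, z, hz, h2.rot, b, c, a, h1.2.1, d, rfl⟩
  have m1 : G.Adj x v → G.Adj y v → G.Adj z v → G.Adj v w → G.InKey M φ v (φ z) :=
    fun a b c d => ⟨x, hx, y, hy, z, hz, w, hw, h1, a, b, c, h2.2.2, d, c2⟩
  have m2 : G.Adj x v → G.Adj y v → G.Adj w v → G.Adj v z → G.InKey M φ v (φ z) :=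
    fun a b c d => ⟨x, hx, y, hy, w, hw, z, hz, h2, a, b, c, h1.2.2, d, c2⟩
  have u1 : ∀ κ κ', G.OutKey M φ v κ → G.OutKey M φ v κ' → κ = κ' :=
    fun _ _ a b => a.unique h hφ b
  have u2 : ∀ κ κ', G.InKey M φ v κ → G.InKey M φ v κ' → κ = κ' :=
    fun _ _ a b => a.unique h hφ b
  have n : ∀ {z w}, G.Cyc x y z → G.Cyc x y w → G.Adj x v → G.Adj v y → G.Adj v z →
      G.Adj w v → False := by
    intro z w h1 h2 xv vy vz wv
    rcases h.adj_or_adj ⟨vz, h1.2.2, xv⟩ ⟨vy, h2.2.1, wv⟩ with h3 | h3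
    · exact h x y z w v h1 h2 ⟨h3, wv, vz⟩
    · exact G.asymm h1.1 h3
  have n1 := n h1 h2
  have n2 := n h2 h1
  have tx := tot hx
  have ty := tot hy
  have tz := tot hz
  have tw := tot hw
  have ax := @as x
  have ay := @as y
  have az := @as z
  have aw := @as w
  unfold Compatible at *
  clear n tot as h hφ h1 h2
  rcases tx with tx | tx <;> rcases ty with ty | ty <;> rcases tz with tz | tz <;>
    rcases tw with tw | tw <;> grind

/-- Compatibility is carried along linked triangles, including those that v does not separate, where
the keys store the forced colour. -/
theorem LinkFree.color_eq (h : G.LinkFree) {M : Set V} {φ : V → ZMod 3}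
    (hφ : G.CyclicColoring M φ) {v : V} (hv : v ∉ M) {a b c x y z : V}
    (ha : a ∈ M) (hb : b ∈ M) (hc : c ∈ M) (ht : G.Cyc a b c)
    (hl : G.Linked M a b c x y z) (va : G.Adj v a) (bv : G.Adj b v) (vx : G.Adj v x)
    (yv : G.Adj y v) : φ x = φ a := by
  have as := @asymm V G
  have key : G.Compatible M φ v (φ a) x y z := by
    clear vx yv
    induction hl with
    | refl =>
      have c2 : φ b = φ a + 1 := hφ _ ha _ hb _ hc ht
      exact ⟨fun _ _ => rfl, fun h _ => (as h bv).elim, fun _ h => (as h va).elim,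
        fun _ h _ => (as h bv).elim, fun h _ _ => (as h va).elim⟩
    | rot _ ih =>
      exact ⟨ih.2.1, ih.2.2.1, ih.1, fun x y z => ih.2.2.2.1 z x y,
        fun x y z => ih.2.2.2.2 z x y⟩
    | swap hl hw ht' ih =>
      have := hl.mem ⟨ha, hb, hc⟩
      exact h.compatible_swap hφ hv this.1 this.2.1 this.2.2 hw (hl.cyc ht) ht' ih
  exact key.1 vx yv

/-- `M` is covered by cyclic triangles, any two of which are linked, and it has a colouring. -/
structure Spread (G : Tournament V) (M : Set V) (φ : V → ZMod 3) : Prop where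
  cover : ∀ x ∈ M, ∃ y ∈ M, ∃ z ∈ M, G.Cyc x y z
  linked : ∀ a ∈ M, ∀ b ∈ M, ∀ c ∈ M, G.Cyc a b c → ∀ x ∈ M, ∀ y ∈ M, ∀ z ∈ M, G.Cyc x y z →
    G.Linked M a b c x y z
  coloring : G.CyclicColoring M φ

theorem exists_spread_triangle {a b c : V} (ht : G.Cyc a b c) :
    ∃ φ, G.Spread {a, b, c} φ := by
  classical
  have hab := G.ne_of_adj ht.1
  have hbc := G.ne_of_adj ht.2.1
  have hca := G.ne_of_adj ht.2.2
  have tri : ∀ x ∈ ({a, b, c} : Set V), ∀ y ∈ ({a, b, c} : Set V), ∀ z ∈ ({a, b, c} : Set V),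
      G.Cyc x y z → (x = a ∧ y = b ∧ z = c) ∨ (x = b ∧ y = c ∧ z = a) ∨
        (x = c ∧ y = a ∧ z = b) := by
    have as := @asymm V G
    have irr := G.loopless
    simp only [Cyc, Set.mem_insert_iff, Set.mem_singleton_iff] at *
    rintro x (rfl | rfl | rfl) y (rfl | rfl | rfl) z (rfl | rfl | rfl) <;> grind
  refine ⟨fun x => if x = a then 0 else if x = b then 1 else 2, ?_, ?_, ?_⟩
  · rintro x (rfl | rfl | rfl)
    · exact ⟨b, by simp, c, by simp, ht⟩
    · exact ⟨c, by simp, a, by simp, ht.rot⟩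
    · exact ⟨a, by simp, b, by simp, ht.rot.rot⟩
  · intro x hx y hy z hz h1 x' hx' y' hy' z' hz' h2
    have l : ∀ x y z, (x = a ∧ y = b ∧ z = c) ∨ (x = b ∧ y = c ∧ z = a) ∨
        (x = c ∧ y = a ∧ z = b) → G.Linked {a, b, c} a b c x y z := by
      rintro x y z (⟨rfl, rfl, rfl⟩ | ⟨rfl, rfl, rfl⟩ | ⟨rfl, rfl, rfl⟩)
      exacts [.refl, .rot .refl, .rot (.rot .refl)]
    exact ((l _ _ _ (tri x hx y hy z hz h1)).symm ht (by simp)).trans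
      (l _ _ _ (tri _ hx' _ hy' _ hz' h2))
  · intro x hx y hy z hz h1
    rcases tri x hx y hy z hz h1 with ⟨rfl, rfl, rfl⟩ | ⟨rfl, rfl, rfl⟩ | ⟨rfl, rfl, rfl⟩
    · simp [hab.symm]
    · simp [hab.symm, hbc.symm, hca]
      decide
    · simp [hbc.symm, hca]
      decide

/-- A vertex that distinguishes the vertices of a linked triangle can be added. -/
theorem Spread.exists_insert (h : G.LinkFree) {M : Set V} {φ : V → ZMod 3} (hM : G.Spread M φ) {v : V}
    (hv : v ∉ M) {a b c : V} (ha : a ∈ M) (hb : b ∈ M) (hc : c ∈ M) (ht : G.Cyc a b c)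
    (va : G.Adj v a) (bv : G.Adj b v) : ∃ ψ, G.Spread (insert v M) ψ := by
  classical
  have hsub : M ⊆ insert v M := Set.subset_insert v M
  have hvm : v ∈ insert v M := Set.mem_insert v M
  have hcase : ∀ x ∈ insert v M, ∀ y ∈ insert v M, ∀ z ∈ insert v M, G.Cyc x y z →
      (x ∈ M ∧ y ∈ M ∧ z ∈ M) ∨ (x = v ∧ y ∈ M ∧ z ∈ M) ∨ (y = v ∧ z ∈ M ∧ x ∈ M) ∨
      (z = v ∧ x ∈ M ∧ y ∈ M) := by
    intro x hx y hy z hz h1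
    have n1 := G.ne_of_adj h1.1
    have n2 := G.ne_of_adj h1.2.1
    have n3 := G.ne_of_adj h1.2.2
    simp only [Set.mem_insert_iff] at hx hy hz
    grind
  -- The edge x → y need not lie in a cyclic triangle inside M. Covering triangles at x and at y
  -- either provide one, or give separate edges of such triangles that determine the two colours.
  have hcol : ∀ x ∈ M, ∀ y ∈ M, G.Cyc v x y → φ x = φ a ∧ φ y = φ a + 1 := by
    have base : ∀ x ∈ M, ∀ y ∈ M, ∀ z ∈ M, G.Cyc x y z → G.Adj v x → G.Adj y v →
        φ x = φ a ∧ φ y = φ a + 1 := by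
      intro x hx y hy z hz h1 vx yv
      have e := h.color_eq hM.coloring hv ha hb hc ht
        (hM.linked a ha b hb c hc ht x hx y hy z hz h1) va bv vx yv
      exact ⟨e, e ▸ hM.coloring x hx y hy z hz h1⟩
    intro x hx y hy h1
    obtain ⟨p, hp, q, hq, h2⟩ := hM.cover x hx
    obtain ⟨r, hr, s, hs, h3⟩ := hM.cover y hy
    rcases h.adj_or_adj h1.rot h2 with h4 | h4
    · exact base x hx y hy q hq ⟨h1.2.1, h4, h2.2.2⟩ h1.1 h1.2.2
    · rcases h.adj_or_adj h1.rot.rot h3 with h5 | h5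
      · exact ⟨(base x hx p hp q hq h2 h1.1 h4).1,
          (base s hs y hy r hr h3.rot.rot h5 h1.2.2).2⟩
      · exact base x hx y hy r hr ⟨h1.2.1, h3.1, h5⟩ h1.1 h1.2.2
  have hlink : ∀ x ∈ insert v M, ∀ y ∈ insert v M, ∀ z ∈ insert v M, G.Cyc x y z →
      G.Linked (insert v M) v a b x y z := by
    have hvab : G.Cyc v a b := ⟨va, ht.1, bv⟩
    have hn : ∀ x ∈ M, ∀ y ∈ M, G.Cyc v x y → G.Linked (insert v M) v a b v x y :=
      fun x hx y hy h1 => h.linked (hsub hx) (hsub hy) hvab h1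
    intro x hx y hy z hz h1
    rcases hcase x hx y hy z hz h1 with ⟨hx, hy, hz⟩ | ⟨rfl, hy, hz⟩ | ⟨rfl, hz, hx⟩ |
      ⟨rfl, hx, hy⟩
    · exact (Linked.refl.rot.swap (hsub hc) ht).trans
        ((hM.linked a ha b hb c hc ht x hx y hy z hz h1).mono hsub)
    · exact hn y hy z hz h1
    · exact (hn z hz x hx h1.rot).rot.rot
    · exact (hn x hx y hy h1.rot.rot).rot
  -- The colour of v is forced by the edge v → a of the cyclic triangle v, a, b.
  refine ⟨Function.update φ v (φ a - 1), ?_, ?_, ?_⟩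
  · rintro x (rfl | hx)
    · exact ⟨a, hsub ha, b, hsub hb, va, ht.1, bv⟩
    · obtain ⟨y, hy, z, hz, h1⟩ := hM.cover x hx
      exact ⟨y, hsub hy, z, hsub hz, h1⟩
  · intro x hx y hy z hz h1 x' hx' y' hy' z' hz' h2
    exact ((hlink x hx y hy z hz h1).symm ⟨va, ht.1, bv⟩ ⟨hvm, hsub ha, hsub hb⟩).trans
      (hlink x' hx' y' hy' z' hz' h2)
  · have up : ∀ x ∈ M, Function.update φ v (φ a - 1) x = φ x := fun x hx =>
      Function.update_of_ne (by rintro rfl; exact hv hx) _ _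
    have e3 : (1 : ZMod 3) + 1 = -1 := by decide
    intro x hx y hy z hz h1
    rcases hcase x hx y hy z hz h1 with ⟨hx, hy, hz⟩ | ⟨rfl, hy, hz⟩ | ⟨rfl, hz, hx⟩ |
      ⟨rfl, hx, hy⟩
    · rw [up x hx, up y hy]
      exact hM.coloring x hx y hy z hz h1
    · rw [up y hy, Function.update_self, (hcol y hy z hz h1).1]
      ring
    · rw [up x hx, Function.update_self, (hcol z hz x hx h1.rot).2, add_assoc, e3]
      ring
    · rw [up x hx, up y hy, (hcol x hx y hy h1.rot.rot).1, (hcol x hx y hy h1.rot.rot).2]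

/-- Take a maximal spread set containing a, b, c. By `Spread.exists_insert` no outside vertex
separates a triangle in it; linkedness makes the set homogeneous, and primeness makes it everything.
-/
theorem Spread.exists_univ [Finite V] (h : G.LinkFree) (hp : G.IsPrime) {a b c : V}
    (ht : G.Cyc a b c) : ∃ φ, G.Spread Set.univ φ := by
  obtain ⟨M, hM⟩ := (Set.toFinite {M : Set V | (∃ φ, G.Spread M φ) ∧ a ∈ M ∧ b ∈ M ∧ c ∈ M}).exists_maximal
    ⟨{a, b, c}, exists_spread_triangle ht, by simp⟩
  obtain ⟨⟨⟨φ, hφ⟩, ha, hb, hc⟩, hmax⟩ := hM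
  have hno : ∀ v ∉ M, ∀ x ∈ M, ∀ y ∈ M, ∀ z ∈ M, G.Cyc x y z → ¬ (G.Adj v x ∧ G.Adj y v) := by
    rintro v hv x hx y hy z hz h1 ⟨vx, yv⟩
    have hs : M ⊆ insert v M := Set.subset_insert v M
    exact hv (hmax ⟨hφ.exists_insert h hv hx hy hz h1 vx yv, hs ha, hs hb, hs hc⟩ hs
      (Set.mem_insert v M))
  have hom : G.Homogeneous M := by
    intro v hv
    have tot : ∀ {x}, x ∈ M → G.Adj v x ∨ G.Adj x v := fun hx => G.total (by
      rintro rfl; exact hv hx)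
    have hno' : ∀ x ∈ M, ∀ y ∈ M, ∀ z ∈ M, G.Cyc x y z → (G.Adj v x → G.Adj v y) := by
      intro x hx y hy z hz h1 vx
      exact (tot hy).resolve_right fun h => hno v hv x hx y hy z hz h1 ⟨vx, h⟩
    have key : ∀ x y z, G.Linked M a b c x y z →
        (G.Adj v x ↔ G.Adj v a) ∧ (G.Adj v y ↔ G.Adj v a) ∧ (G.Adj v z ↔ G.Adj v a) := by
      intro x y z hl
      induction hl with
      | refl =>
        have := hno' a ha b hb c hc ht
        have := hno' b hb c hc a ha ht.rot
        have := hno' c hc a ha b hb ht.rot.rot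
        tauto
      | rot _ ih => exact ⟨ih.2.1, ih.2.2, ih.1⟩
      | @swap x y z w hl hw h1 ih =>
        obtain ⟨hx, hy, -⟩ := hl.mem ⟨ha, hb, hc⟩
        have := hno' y hy w hw x hx h1.rot
        have := hno' w hw x hx y hy h1.rot.rot
        tauto
    have key' : ∀ x ∈ M, (G.Adj v x ↔ G.Adj v a) := by
      intro x hx
      obtain ⟨y, hy, z, hz, h1⟩ := hφ.cover x hx
      exact (key x y z (hφ.linked a ha b hb c hc ht x hx y hy z hz h1)).1
    by_cases hva : G.Adj v a
    · exact Or.inl fun x hx => (key' x hx).2 hva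
    · exact Or.inr fun x hx => (tot hx).resolve_left fun h => hva ((key' x hx).1 h)
  rcases hp M hom with h1 | h1
  · exact (G.ne_of_adj ht.1 (h1 ha hb)).elim
  · exact ⟨φ, h1 ▸ hφ⟩

/-- The structure of prime `U₅`-free tournaments with a cyclic triangle: they are locally
transitive, or their vertices can be coloured cyclically along the cyclic triangles. -/
theorem NoU5.structure [Finite V] (hU : G.NoU5) (hp : G.IsPrime) {a b c : V}
    (ht : G.Cyc a b c) : G.LocallyTransitive ∨
      ∃ φ : V → ZMod 3, ∀ a b c, G.Cyc a b c → φ b = φ a + 1 := by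
  by_cases hq : ∃ a b c d e, G.Pent a b c d e
  · obtain ⟨_, _, _, _, _, hq⟩ := hq
    exact Or.inl (hU.locallyTransitive hp hq)
  · push Not at hq
    obtain ⟨φ, hφ⟩ := Spread.exists_univ (hU.linkFree (hU.noBlownTriangle hp) hq) hp ht
    exact Or.inr ⟨φ, fun a b c h => hφ.coloring a trivial b trivial c trivial h⟩


/-! ### Inequalities for the exponent log_2 3. -/

theorem one_le_logb_two_three : 1 ≤ Real.logb 2 3 := by
  rw [Real.le_logb_iff_rpow_le (by norm_num) (by norm_num)]
  norm_num

theorem sum_rpow_le {V : Type*} (S : Finset V) {w : V → ℝ} (hw : ∀ x, 0 ≤ w x) {p : ℝ}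
    (hp : 1 ≤ p) : ∑ x ∈ S, w x ^ p ≤ (∑ x ∈ S, w x) ^ p := by
  classical
  induction S using Finset.induction_on with
  | empty => simpa using Real.rpow_nonneg le_rfl p
  | insert a S ha ih =>
    rw [Finset.sum_insert ha, Finset.sum_insert ha]
    exact (add_le_add_right ih _).trans
      (Real.add_rpow_le_rpow_add (hw a) (Finset.sum_nonneg fun x _ => hw x) hp)

/-- The points x and 2y are complementary convex combinations of y and x + y, so convexity gives x^p
+ (2y)^p ≤ y^p + (x+y)^p; finally (2y)^p = 3y^p. -/
theorem rpow_add_two_mul_rpow_le {x y : ℝ} (hy : 0 ≤ y) (hxy : y ≤ x) :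
    x ^ Real.logb 2 3 + 2 * y ^ Real.logb 2 3 ≤ (x + y) ^ Real.logb 2 3 := by
  set p := Real.logb 2 3 with hp
  have h2 : (2 : ℝ) ^ p = 3 := Real.rpow_logb (by norm_num) (by norm_num) (by norm_num)
  rcases hy.eq_or_lt with rfl | hy0
  · have : p ≠ 0 := (zero_lt_one.trans_le one_le_logb_two_three).ne'
    simp [Real.zero_rpow this]
  have hx : 0 < x := hy0.trans_le hxy
  have hc := (convexOn_rpow one_le_logb_two_three).2
  have m1 : y ∈ Set.Ici (0 : ℝ) := hy
  have m2 : x + y ∈ Set.Ici (0 : ℝ) := by simp only [Set.mem_Ici]; positivity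
  have e1 := hc m1 m2 (a := y / x) (b := 1 - y / x) (by positivity)
    (sub_nonneg.2 ((div_le_one hx).2 hxy)) (by ring)
  have e2 := hc m2 m1 (a := y / x) (b := 1 - y / x) (by positivity)
    (sub_nonneg.2 ((div_le_one hx).2 hxy)) (by ring)
  simp only [smul_eq_mul] at e1 e2
  have f1 : y / x * y + (1 - y / x) * (x + y) = x := by field_simp; ring
  have f2 : y / x * (x + y) + (1 - y / x) * y = 2 * y := by field_simp; ring
  rw [f1] at e1
  rw [f2, Real.mul_rpow (by norm_num) hy, ← hp, h2] at e2
  rw [← hp] at e1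
  linarith

/-- Drop the smallest entry: its power is at most that of the smaller remaining entry, which reduces
to `rpow_add_two_mul_rpow_le`. -/
theorem exists_rpow_add_le {T : ZMod 3 → ℝ} (hT : ∀ i, 0 ≤ T i) :
    ∃ i, ∑ j, T j ^ Real.logb 2 3 ≤ (∑ j, T j - T i) ^ Real.logb 2 3 := by
  have key : ∀ x y z : ℝ, 0 ≤ x → x ≤ y → x ≤ z →
      x ^ Real.logb 2 3 + y ^ Real.logb 2 3 + z ^ Real.logb 2 3 ≤ (y + z) ^ Real.logb 2 3 := by
    intro x y z hx hxy hxz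
    have hp : 0 ≤ Real.logb 2 3 := zero_le_one.trans one_le_logb_two_three
    have e1 := Real.rpow_le_rpow hx hxy hp
    have e2 := Real.rpow_le_rpow hx hxz hp
    rcases le_total y z with h | h
    · have := rpow_add_two_mul_rpow_le (hx.trans hxy) h
      rw [add_comm y z]
      linarith
    · have := rpow_add_two_mul_rpow_le (hx.trans hxz) h
      linarith
  obtain ⟨i, -, hi⟩ := Finset.exists_min_image Finset.univ T ⟨0, Finset.mem_univ _⟩
  have hs : ∀ f : ZMod 3 → ℝ, ∑ j, f j = f i + f (i + 1) + f (i + 2) := by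
    intro f
    rw [← Equiv.sum_comp (Equiv.addLeft i) f]
    refine (Fin.sum_univ_three (fun j : ZMod 3 => f (i + j))).trans ?_
    exact congrArg (fun x => f x + f (i + 1) + f (i + 2)) (add_zero i)
  refine ⟨i, ?_⟩
  rw [hs, hs]
  have := key (T i) _ _ (hT i) (hi (i + 1) (Finset.mem_univ _)) (hi (i + 2) (Finset.mem_univ _))
  convert this using 2
  ring

/-! ### Heavy acyclic sets and the induction. -/

/-- No cyclic triangle has all its vertices in `X`. -/
def Acyclic (G : Tournament V) (X : Finset V) : Prop :=
  ∀ a ∈ X, ∀ b ∈ X, ∀ c ∈ X, ¬ G.Cyc a b c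

/-- A cyclic triangle cannot have exactly two vertices in a homogeneous set, and a single one can be
replaced by r. -/
theorem acyclic_substitute [DecidableEq V] {S B X Y : Finset V} {r : V} (hr : r ∈ B)
    (hom : ∀ v ∈ S, v ∉ B → (∀ a ∈ B, G.Adj v a) ∨ (∀ a ∈ B, G.Adj a v))
    (hX : X ⊆ insert r (S \ B)) (hX' : G.Acyclic X) (hrX : r ∈ X) (hY : Y ⊆ B)
    (hY' : G.Acyclic Y) : G.Acyclic (X.erase r ∪ Y) := by
  have as := @asymm V G
  have h1 : ∀ x ∈ X.erase r ∪ Y, x ∈ Y ∨ (x ∈ X ∧ x ∈ S ∧ x ∉ B) := by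
    intro x hx
    have := @hX x
    simp only [Finset.mem_union, Finset.mem_erase, Finset.mem_insert, Finset.mem_sdiff] at *
    tauto
  have h2 : ∀ v ∈ S, v ∉ B → ∀ y ∈ Y, (G.Adj v y ↔ G.Adj v r) ∧ (G.Adj y v ↔ G.Adj r v) := by
    intro v hv hvB y hy
    rcases hom v hv hvB with h | h
    · exact ⟨iff_of_true (h y (hY hy)) (h r hr), iff_of_false (as (h y (hY hy))) (as (h r hr))⟩
    · exact ⟨iff_of_false (as (h y (hY hy))) (as (h r hr)), iff_of_true (h y (hY hy)) (h r hr)⟩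
  have two : ∀ a ∈ Y, ∀ b ∈ Y, ∀ c ∈ S, c ∉ B → ¬ G.Cyc a b c := by
    rintro a ha b hb c hc hcB ⟨-, bc, ca⟩
    exact as ((h2 c hc hcB b hb).2.1 bc) ((h2 c hc hcB a ha).1.1 ca)
  have one : ∀ a ∈ Y, ∀ b ∈ X, b ∈ S → b ∉ B → ∀ c ∈ X, c ∈ S → c ∉ B → ¬ G.Cyc a b c := by
    intro a ha b hbX hb hbB c hcX hc hcB ⟨ab, bc, ca⟩
    exact hX' r hrX b hbX c hcX
      ⟨(h2 b hb hbB a ha).2.1 ab, bc, (h2 c hc hcB a ha).1.1 ca⟩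
  intro a ha b hb c hc ht
  rcases h1 a ha with ha | ha <;> rcases h1 b hb with hb | hb <;> rcases h1 c hc with hc | hc
  · exact hY' a ha b hb c hc ht
  · exact two a ha b hb c hc.2.1 hc.2.2 ht
  · exact two c hc a ha b hb.2.1 hb.2.2 ht.rot.rot
  · exact one a ha b hb.1 hb.2.1 hb.2.2 c hc.1 hc.2.1 hc.2.2 ht
  · exact two b hb c hc a ha.2.1 ha.2.2 ht.rot
  · exact one b hb c hc.1 hc.2.1 hc.2.2 a ha.1 ha.2.1 ha.2.2 ht.rot
  · exact one c hc a ha.1 ha.2.1 ha.2.2 b hb.1 hb.2.1 hb.2.2 ht.rot.rot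
  · exact hX' a ha.1 b hb.1 c hc.1 ht

/-- `S` contains an acyclic set of large weight, for any weights. -/
def HasHeavySet (G : Tournament V) (S : Finset V) : Prop :=
  ∀ w : V → ℝ, (∀ x, 0 ≤ w x) → ∃ X ⊆ S, G.Acyclic X ∧
    ∑ x ∈ S, w x ^ Real.logb 2 3 ≤ (∑ x ∈ X, w x) ^ Real.logb 2 3

/-- Give r the total weight of a heavy set Y of B, solve the contracted problem, and expand r back
to Y if it was chosen. -/
theorem HasHeavySet.of_homogeneous [DecidableEq V] {S B : Finset V} {r : V} (hB : B ⊆ S)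
    (hr : r ∈ B) (hom : ∀ v ∈ S, v ∉ B → (∀ a ∈ B, G.Adj v a) ∨ (∀ a ∈ B, G.Adj a v))
    (h1 : G.HasHeavySet B) (h2 : G.HasHeavySet (insert r (S \ B))) : G.HasHeavySet S := by
  intro w hw
  obtain ⟨Y, hYB, hYa, hY⟩ := h1 w hw
  have hw' : ∀ x, 0 ≤ Function.update w r (∑ x ∈ Y, w x) x := by
    intro x
    by_cases h : x = r
    · subst h
      simpa using Finset.sum_nonneg fun x _ => hw x
    · simpa [h] using hw x
  have up : ∀ x, x ≠ r → Function.update w r (∑ x ∈ Y, w x) x = w x :=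
    fun x h => Function.update_of_ne h _ _
  obtain ⟨X, hXS, hXa, hX⟩ := h2 _ hw'
  have hrS : r ∉ S \ B := by simp [hr]
  have hle : ∑ x ∈ S, w x ^ Real.logb 2 3 ≤
      (∑ x ∈ X, Function.update w r (∑ x ∈ Y, w x) x) ^ Real.logb 2 3 := by
    refine le_trans ?_ hX
    rw [Finset.sum_insert hrS, Function.update_self, ← Finset.sum_sdiff hB, add_comm]
    refine add_le_add hY (Finset.sum_le_sum fun x hx => ?_)
    rw [up x (by rintro rfl; exact hrS hx)]
  by_cases hrX : r ∈ X
  · refine ⟨X.erase r ∪ Y, ?_, acyclic_substitute hr hom hXS hXa hrX hYB hYa, ?_⟩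
    · intro x hx
      have h3 := @hXS x
      have h4 := @hYB x
      have h5 := @hB x
      simp only [Finset.mem_union, Finset.mem_erase, Finset.mem_insert, Finset.mem_sdiff] at *
      tauto
    · have hd : Disjoint (X.erase r) Y := by
        rw [Finset.disjoint_left]
        intro x hx hxY
        have h3 := @hXS x
        have h4 := hYB hxY
        simp only [Finset.mem_erase, Finset.mem_insert, Finset.mem_sdiff] at *
        tauto
      rw [Finset.sum_union hd]
      rw [← Finset.add_sum_erase X _ hrX, Function.update_self, add_comm] at hle
      rwa [Finset.sum_congr rfl fun x hx => up x (Finset.ne_of_mem_erase hx)] at hle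
  · refine ⟨X, fun x hx => ?_, hXa, ?_⟩
    · rcases Finset.mem_insert.1 (hXS hx) with rfl | h
      · exact hB hr
      · exact (Finset.mem_sdiff.1 h).1
    · rwa [Finset.sum_congr rfl fun x hx => up x (by rintro rfl; exact hrX hx)] at hle

theorem HasHeavySet.of_acyclic {S : Finset V} (hS : G.Acyclic S) : G.HasHeavySet S :=
  fun _ hw => ⟨S, subset_rfl, hS, sum_rpow_le S hw one_le_logb_two_three⟩

/-- Every cyclic triangle uses all three colours, so deleting any colour class leaves an acyclic
set; a lightest class is cheap enough. -/
theorem HasHeavySet.of_coloring {S : Finset V} {φ : V → ZMod 3}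
    (hφ : ∀ a ∈ S, ∀ b ∈ S, ∀ c ∈ S, G.Cyc a b c → φ b = φ a + 1) : G.HasHeavySet S := by
  intro w hw
  obtain ⟨i, hi⟩ := exists_rpow_add_le (T := fun i => ∑ x ∈ S with φ x = i, w x)
    fun i => Finset.sum_nonneg fun x _ => hw x
  refine ⟨S.filter (fun x => ¬ φ x = i), Finset.filter_subset _ _, ?_, ?_⟩
  · intro a ha b hb c hc ht
    rw [Finset.mem_filter] at ha hb hc
    have e1 := hφ a ha.1 b hb.1 c hc.1 ht
    have e2 := hφ b hb.1 c hc.1 a ha.1 ht.rot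
    have : ∀ i x : ZMod 3, x = i ∨ x + 1 = i ∨ x + 1 + 1 = i := by decide
    rcases this i (φ a) with h | h | h
    · exact ha.2 h
    · exact hb.2 (e1.trans h)
    · exact hc.2 (by rw [e2, e1, h])
  · rw [Finset.sum_fiberwise, ← Finset.sum_filter_add_sum_filter_not S (fun x => φ x = i) w,
      add_sub_cancel_left] at hi
    refine le_trans ?_ hi
    rw [← Finset.sum_fiberwise S φ]
    exact Finset.sum_le_sum fun j _ => sum_rpow_le _ hw one_le_logb_two_three

/-- Delete a lightest vertex u and merge its twins a, b into a with weight w a + w b. As w u is at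
most both weights, the merged power pays for all three. If a is chosen, its twin b can be added
without creating a cyclic triangle. -/
theorem HasHeavySet.of_twins [DecidableEq V] {S : Finset V}
    (htw : ∀ u ∈ S, ∃ a ∈ S, ∃ b ∈ S, a ≠ u ∧ b ≠ u ∧ G.Adj a b ∧
      ∀ x ∈ S, x ≠ u → x ≠ a → x ≠ b → (G.Adj x a ↔ G.Adj x b))
    (hne : S.Nonempty) (ih : ∀ S' ⊂ S, G.HasHeavySet S') : G.HasHeavySet S := by
  intro w hw
  obtain ⟨u, hu, hmin⟩ := S.exists_min_image w hne
  obtain ⟨a, ha, b, hb, hau, hbu, hab, htw⟩ := htw u hu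
  have hne := G.ne_of_adj hab
  have as := @asymm V G
  have hmem : ∀ x, x ∈ (S.erase u).erase b ↔ x ≠ b ∧ x ≠ u ∧ x ∈ S := by simp
  have haS : a ∈ (S.erase u).erase b := (hmem a).2 ⟨hne, hau, ha⟩
  have hbS : b ∈ S.erase u := Finset.mem_erase.2 ⟨hbu, hb⟩
  have hw' : ∀ x, 0 ≤ Function.update w a (w a + w b) x := by
    intro x
    by_cases h : x = a
    · subst h
      simpa using add_nonneg (hw x) (hw b)
    · simpa [h] using hw x
  have up : ∀ x, x ≠ a → Function.update w a (w a + w b) x = w x :=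
    fun x h => Function.update_of_ne h _ _
  obtain ⟨X, hXS, hXa, hX⟩ := ih ((S.erase u).erase b)
    ((Finset.erase_subset _ _).trans_ssubset (Finset.erase_ssubset hu)) _ hw'
  have hmerge : w u ^ Real.logb 2 3 + (w b ^ Real.logb 2 3 + w a ^ Real.logb 2 3) ≤
      (w a + w b) ^ Real.logb 2 3 := by
    have hp : 0 ≤ Real.logb 2 3 := zero_le_one.trans one_le_logb_two_three
    have e1 := Real.rpow_le_rpow (hw u) (hmin a ha) hp
    have e2 := Real.rpow_le_rpow (hw u) (hmin b hb) hp
    rcases le_total (w a) (w b) with h | h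
    · have := rpow_add_two_mul_rpow_le (hw a) h
      rw [add_comm (w a)]
      linarith
    · have := rpow_add_two_mul_rpow_le (hw b) h
      linarith
  have hle : ∑ x ∈ S, w x ^ Real.logb 2 3 ≤
      (∑ x ∈ X, Function.update w a (w a + w b) x) ^ Real.logb 2 3 := by
    refine le_trans ?_ hX
    have hr : ∑ x ∈ ((S.erase u).erase b).erase a,
        Function.update w a (w a + w b) x ^ Real.logb 2 3 =
        ∑ x ∈ ((S.erase u).erase b).erase a, w x ^ Real.logb 2 3 :=
      Finset.sum_congr rfl fun x hx => by rw [up x (Finset.ne_of_mem_erase hx)]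
    rw [← Finset.add_sum_erase S _ hu, ← Finset.add_sum_erase _ _ hbS,
      ← Finset.add_sum_erase _ _ haS, ← Finset.add_sum_erase _ _ haS, Function.update_self, hr]
    linarith
  by_cases haX : a ∈ X
  · have hbX : b ∉ X := fun h => ((hmem b).1 (hXS h)).1 rfl
    refine ⟨insert b X, ?_, ?_, ?_⟩
    · rintro x hx
      rcases Finset.mem_insert.1 hx with rfl | h
      · exact hb
      · exact ((hmem x).1 (hXS h)).2.2
    · have key : ∀ x ∈ X, ∀ y ∈ X, ¬ G.Cyc b x y := by
        rintro x hx y hy ⟨bx, xy, yb⟩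
        have nx := (hmem x).1 (hXS hx)
        have ny := (hmem y).1 (hXS hy)
        have xa : x ≠ a := by rintro rfl; exact as bx hab
        have ax : G.Adj a x := by
          by_contra h
          have := (G.total xa).resolve_right h
          exact as bx ((htw x nx.2.2 nx.2.1 xa nx.1).1 this)
        by_cases ya : y = a
        · subst ya
          exact as ax xy
        · exact hXa a haX x hx y hy ⟨ax, xy, (htw y ny.2.2 ny.2.1 ya ny.1).2 yb⟩
      intro x hx y hy z hz ht
      rcases Finset.mem_insert.1 hx with rfl | hx'
      · have hy' := Finset.mem_of_mem_insert_of_ne hy (G.ne_of_adj ht.1).symm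
        have hz' := Finset.mem_of_mem_insert_of_ne hz (G.ne_of_adj ht.2.2)
        exact key y hy' z hz' ht
      rcases Finset.mem_insert.1 hy with rfl | hy'
      · have hz' := Finset.mem_of_mem_insert_of_ne hz (G.ne_of_adj ht.2.1).symm
        exact key z hz' x hx' ht.rot
      rcases Finset.mem_insert.1 hz with rfl | hz'
      · exact key x hx' y hy' ht.rot.rot
      · exact hXa x hx' y hy' z hz' ht
    · rw [Finset.sum_insert hbX, ← Finset.add_sum_erase X _ haX]
      rw [← Finset.add_sum_erase X _ haX, Function.update_self,
        Finset.sum_congr rfl fun x hx => up x (Finset.ne_of_mem_erase hx)] at hle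
      rwa [← add_assoc, add_comm (w b)]
  · refine ⟨X, fun x hx => ((hmem x).1 (hXS hx)).2.2, hXa, ?_⟩
    rwa [Finset.sum_congr rfl fun x hx => up x (by rintro rfl; exact haX hx)] at hle

theorem NoU5.induce (hU : G.NoU5) (S : Set V) : (G.induce S).NoU5 :=
  fun a b c d e => hU a b c d e

theorem NoU5.hasHeavySet (hU : G.NoU5) (S : Finset V) : G.HasHeavySet S := by
  classical
  induction S using Finset.strongInduction with
  | H S ih =>
  by_cases hp : (G.induce (S : Set V)).IsPrime
  · by_cases hS : G.Acyclic S
    · exact .of_acyclic hS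
    unfold Acyclic at hS
    push Not at hS
    obtain ⟨a, ha, b, hb, c, hc, ht⟩ := hS
    have ht' : (G.induce (S : Set V)).Cyc ⟨a, ha⟩ ⟨b, hb⟩ ⟨c, hc⟩ := ht
    rcases (hU.induce _).structure hp ht' with hL | ⟨φ, hφ⟩
    · refine .of_twins (fun u hu => ?_) ⟨a, ha⟩ ih
      obtain ⟨x, y, h1, h2, h3, h4⟩ := hL.exists_twins hp ht' ⟨u, hu⟩
      exact ⟨x, x.2, y, y.2, fun e => h1 (Subtype.ext e), fun e => h2 (Subtype.ext e), h3,
        fun z hz n1 n2 n3 => h4 ⟨z, hz⟩ (fun e => n1 (congrArg Subtype.val e))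
          (fun e => n2 (congrArg Subtype.val e)) (fun e => n3 (congrArg Subtype.val e))⟩
    · refine .of_coloring (φ := fun x => if h : x ∈ S then φ ⟨x, h⟩ else 0) ?_
      intro a ha b hb c hc ht
      simpa [ha, hb] using hφ ⟨a, ha⟩ ⟨b, hb⟩ ⟨c, hc⟩ ht
  · unfold IsPrime at hp
    push Not at hp
    obtain ⟨A, hA, hns, hnu⟩ := hp
    obtain ⟨r, hr, s, hs, hrs⟩ := hns
    obtain ⟨t, ht⟩ := (Set.ne_univ_iff_exists_notMem A).1 hnu
    have hmem : ∀ x, x ∈ S.filter (fun x => ∃ h : x ∈ S, (⟨x, h⟩ : (S : Set V)) ∈ A) ↔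
        ∃ h : x ∈ S, (⟨x, h⟩ : (S : Set V)) ∈ A := by
      intro x
      rw [Finset.mem_filter]
      exact ⟨fun h => h.2, fun h => ⟨h.1, h⟩⟩
    generalize S.filter (fun x => ∃ h : x ∈ S, (⟨x, h⟩ : (S : Set V)) ∈ A) = B at hmem
    have hB : B ⊆ S := fun x hx => ((hmem x).1 hx).1
    have hrB : (r : V) ∈ B := (hmem r).2 ⟨r.2, hr⟩
    have hsB : (s : V) ∈ B := (hmem s).2 ⟨s.2, hs⟩
    refine .of_homogeneous hB hrB ?_ (ih B ?_) (ih _ ?_)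
    · intro v hv hvB
      have hvA : (⟨v, hv⟩ : (S : Set V)) ∉ A := fun h => hvB ((hmem v).2 ⟨hv, h⟩)
      rcases hA _ hvA with h | h
      · refine Or.inl fun x hx => ?_
        obtain ⟨h1, h2⟩ := (hmem x).1 hx
        exact h _ h2
      · refine Or.inr fun x hx => ?_
        obtain ⟨h1, h2⟩ := (hmem x).1 hx
        exact h _ h2
    · refine Finset.ssubset_iff_subset_ne.2 ⟨hB, fun e => ?_⟩
      have : (t : V) ∈ B := e.ge t.2
      obtain ⟨h1, h2⟩ := (hmem t).1 this
      exact ht h2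
    -- The contraction is strictly smaller because B has a second element s besides r.
    · refine (Finset.ssubset_iff_of_subset ?_).2 ⟨s, s.2, ?_⟩
      · intro x hx
        rcases Finset.mem_insert.1 hx with rfl | h
        · exact hB hrB
        · exact (Finset.mem_sdiff.1 h).1
      · rw [Finset.mem_insert, Finset.mem_sdiff]
        rintro (h | h)
        · exact hrs (Subtype.ext h.symm)
        · exact h.2 hsB


/-! ### From freeness to the lower bound. -/

/-- Between tournaments, an edge-preserving map is automatically injective and reflects edges. -/
theorem isFree_iff {V W : Type*} {G : Tournament V} {H : Tournament W} :
    G.IsFree H ↔ ∀ f : W → V, ¬ ∀ i j, H.Adj i j → G.Adj (f i) (f j) := by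
  constructor
  · intro h f hf
    have hinj : Function.Injective f := by
      intro i j e
      by_contra hne
      rcases H.total hne with h1 | h1
      · exact G.ne_of_adj (hf _ _ h1) e
      · exact G.ne_of_adj (hf _ _ h1) e.symm
    have hiff : ∀ i j, G.Adj (f i) (f j) ↔ H.Adj i j := by
      refine fun i j => ⟨fun h1 => ?_, hf i j⟩
      have hne : i ≠ j := fun e => G.ne_of_adj h1 (congrArg f e)
      exact (H.total hne).resolve_right fun h2 => G.asymm h1 (hf _ _ h2)
    exact h (Set.range f) ⟨(RelIso.mk (Equiv.ofInjective f hinj) fun {i j} => hiff i j).symm⟩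
  · rintro h X ⟨e⟩
    exact h (fun i => e.symm i) fun i j hij => e.symm.map_rel_iff.2 hij

theorem IsFree.noU5 {V : Type*} {G : Tournament V} (h : G.IsFree U5) : G.NoU5 := by
  intro a b c d e h1 h2 h3 h4 h5 h6 h7 h8 h9 h10
  refine isFree_iff.1 h ![a, b, c, d, e] fun i j hij => ?_
  simp only [U5] at hij
  fin_cases i <;> fin_cases j <;> first | assumption | exact absurd hij (by decide)

theorem isTransitive_induce_iff {V : Type*} {G : Tournament V} {X : Finset V} :
    (G.induce (X : Set V)).IsTransitive ↔ G.Acyclic X := by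
  constructor
  · intro h a ha b hb c hc ht
    exact h ⟨⟨a, ha⟩, ⟨b, hb⟩, ⟨c, hc⟩, ht⟩
  · rintro h ⟨a, b, c, ht⟩
    exact h a a.2 b b.2 c c.2 ht

theorem IsFree.exists_transitive {V : Type*} [Fintype V] {G : Tournament V} (h : G.IsFree U5) :
    ∃ X : Finset V, (G.induce (X : Set V)).IsTransitive ∧
      (Fintype.card V : ℝ) ^ Real.logb 3 2 ≤ (X.card : ℝ) := by
  obtain ⟨X, -, hX, hle⟩ := h.noU5.hasHeavySet Finset.univ (fun _ => 1) fun _ => zero_le_one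
  refine ⟨X, isTransitive_induce_iff.2 hX, ?_⟩
  simp only [Real.one_rpow, Finset.sum_const, nsmul_eq_mul, mul_one, Finset.card_univ] at hle
  have hc : 0 ≤ Real.logb 3 2 := Real.logb_nonneg (by norm_num) (by norm_num)
  -- Unit weights gave |V| ≤ |X|^(log_2 3); the exponents log_2 3 and log_3 2 are inverse to each
  -- other.
  refine (Real.rpow_le_rpow (Nat.cast_nonneg _) hle hc).trans_eq ?_
  rw [← Real.rpow_mul (Nat.cast_nonneg _), ← Real.inv_logb 3 2, inv_mul_cancel₀, Real.rpow_one]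
  exact (Real.logb_pos (by norm_num) (by norm_num)).ne'

/-! ### Tightness: iterated substitutions of T₃. -/

/-- Checked over all colour tuples. It forces any copy of U₅ in a substitution into T₃ to lie in a
single part. -/
theorem U5.const_of_hom_T3 (c : Fin 5 → Fin 3)
    (h : ∀ i j, U5.Adj i j → c i = c j ∨ T3.Adj (c i) (c j)) (i : Fin 5) : c i = c 0 := by
  have key : ∀ a b c d e : Fin 3, (b = a ∨ a - b = 1) → (a = c ∨ c - a = 1) →
      (b = c ∨ c - b = 1) → (b = d ∨ d - b = 1) → (c = d ∨ d - c = 1) → (c = e ∨ e - c = 1) →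
      (d = e ∨ e - d = 1) → (d = a ∨ a - d = 1) → (e = a ∨ a - e = 1) → (e = b ∨ b - e = 1) →
      b = a ∧ c = a ∧ d = a ∧ e = a := by decide
  have := key (c 0) (c 1) (c 2) (c 3) (c 4) (h _ _ (by simp only [U5]; decide))
    (h _ _ (by simp only [U5]; decide)) (h _ _ (by simp only [U5]; decide))
    (h _ _ (by simp only [U5]; decide)) (h _ _ (by simp only [U5]; decide))
    (h _ _ (by simp only [U5]; decide)) (h _ _ (by simp only [U5]; decide))
    (h _ _ (by simp only [U5]; decide)) (h _ _ (by simp only [U5]; decide))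
    (h _ _ (by simp only [U5]; decide))
  fin_cases i
  exacts [rfl, this.1, this.2.1, this.2.2.1, this.2.2.2]

theorem isFree_T3 : T3.IsFree U5 := by
  refine isFree_iff.2 fun f hf => ?_
  have h0 := U5.const_of_hom_T3 f (fun i j h => Or.inr (hf i j h)) 1
  exact T3.ne_of_adj (hf 1 0 (by simp only [U5]; decide)) h0

theorem IsFree.subst_T3 {V : Fin 3 → Type*} {H : ∀ i, Tournament (V i)}
    (h : ∀ i, (H i).IsFree U5) : (T3.subst H).IsFree U5 := by
  refine isFree_iff.2 fun f hf => ?_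
  have hf' : ∀ i j, U5.Adj i j → T3.Adj (f i).1 (f j).1 ∨
      ∃ e : (f i).1 = (f j).1, (H (f j).1).Adj (e ▸ (f i).2) (f j).2 :=
    fun i j hij => Sigma.lex_iff.1 (hf i j hij)
  have h0 := U5.const_of_hom_T3 (fun i => (f i).1) fun i j hij =>
    (hf' i j hij).elim Or.inr fun e => Or.inl e.1
  have : ∀ i, ∃ v : V (f 0).1, f i = ⟨(f 0).1, v⟩ := fun i =>
    ⟨h0 i ▸ (f i).2, Sigma.ext (h0 i) (by simp)⟩
  choose g hg using this
  refine isFree_iff.1 (h (f 0).1) g fun i j hij => ?_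
  have := hf i j hij
  rw [hg i, hg j] at this
  rcases Sigma.lex_iff.1 this with h1 | ⟨e, h1⟩
  · exact (T3.loopless _ h1).elim
  · exact h1

theorem isFree_iterT3 (n : ℕ) : (iterT3 (n + 1)).IsFree U5 := by
  induction n with
  | zero => exact isFree_T3
  | succ n ih => exact IsFree.subst_T3 fun _ => ih

theorem finite_iterVertex (n : ℕ) : Finite (IterVertex (n + 1)) := by
  induction n with
  | zero => exact inferInstanceAs (Finite (Fin 3))
  | succ n ih => exact inferInstanceAs (Finite (Σ _ : Fin 3, IterVertex (n + 1)))

theorem card_iterVertex (n : ℕ) : Nat.card (IterVertex (n + 1)) = 3 ^ (n + 1) := by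
  induction n with
  | zero => exact Nat.card_fin 3
  | succ n ih =>
    have := finite_iterVertex n
    refine (Nat.card_sigma (β := fun _ : Fin 3 => IterVertex (n + 1))).trans ?_
    simp only [ih, Finset.sum_const, Finset.card_univ, Fintype.card_fin, smul_eq_mul]
    ring

/-- Representatives of all three parts would form a cyclic triangle, so an acyclic set misses a part
and has at most k vertices in each of the other two. -/
theorem card_le_of_acyclic_subst {V : Type*} {H : Tournament V} {k : ℕ}
    (hH : ∀ Y : Finset V, H.Acyclic Y → Y.card ≤ k) (X : Finset (Σ _ : Fin 3, V))
    (hX : (T3.subst fun _ => H).Acyclic X) : X.card ≤ 2 * k := by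
  classical
  have hcard : X.card = ∑ i : Fin 3, (X.filter fun x => x.1 = i).card :=
    Finset.card_eq_sum_card_fiberwise fun _ _ => Finset.mem_coe.2 (Finset.mem_univ _)
  have hle : ∀ i, (X.filter fun x => x.1 = i).card ≤ k := by
    intro i
    rw [← Finset.card_image_of_injOn (f := Sigma.snd)]
    · refine hH _ ?_
      simp only [Acyclic, Finset.mem_image, Finset.mem_filter]
      rintro _ ⟨⟨_, a⟩, ⟨ha, rfl⟩, rfl⟩ _ ⟨⟨_, b⟩, ⟨hb, rfl⟩, rfl⟩ _ ⟨⟨_, c⟩, ⟨hc, rfl⟩, rfl⟩ ht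
      exact hX _ ha _ hb _ hc
        ⟨Sigma.Lex.right _ _ ht.1, Sigma.Lex.right _ _ ht.2.1, Sigma.Lex.right _ _ ht.2.2⟩
    · rintro ⟨i', a⟩ ha ⟨j', b⟩ hb hab
      obtain rfl : i' = i := (Finset.mem_filter.1 ha).2
      obtain rfl : j' = i' := (Finset.mem_filter.1 hb).2
      obtain rfl : a = b := hab
      rfl
  have hempty : ∃ i, (X.filter fun x => x.1 = i).card = 0 := by
    by_contra hcon
    push Not at hcon
    have hex : ∀ i, ∃ a, (⟨i, a⟩ : Σ _ : Fin 3, V) ∈ X := by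
      intro i
      obtain ⟨⟨j, a⟩, ha⟩ := Finset.card_ne_zero.1 (hcon i)
      obtain rfl : j = i := (Finset.mem_filter.1 ha).2
      exact ⟨a, (Finset.mem_filter.1 ha).1⟩
    obtain ⟨a, ha⟩ := hex 0
    obtain ⟨b, hb⟩ := hex 1
    obtain ⟨c, hc⟩ := hex 2
    exact hX _ ha _ hb _ hc ⟨Sigma.Lex.left _ _ (by simp only [T3]; decide),
      Sigma.Lex.left _ _ (by simp only [T3]; decide), Sigma.Lex.left _ _ (by simp only [T3]; decide)⟩
  obtain ⟨i, hi⟩ := hempty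
  rw [hcard, ← Finset.add_sum_erase _ _ (Finset.mem_univ i), hi, zero_add]
  refine (Finset.sum_le_card_nsmul _ _ k fun j _ => hle j).trans_eq ?_
  simp

theorem card_le_of_acyclic_iterT3 (n : ℕ) : ∀ X : Finset (IterVertex (n + 1)),
    (iterT3 (n + 1)).Acyclic X → X.card ≤ 2 ^ (n + 1) := by
  induction n with
  | zero =>
    intro (X : Finset (Fin 3)) (hX : T3.Acyclic X)
    by_contra hcon
    have h3 : X = Finset.univ := by
      refine Finset.eq_univ_of_card X (le_antisymm (Finset.card_le_univ X) ?_)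
      exact not_le.1 hcon
    subst h3
    refine hX 0 (Finset.mem_univ _) 1 (Finset.mem_univ _) 2 (Finset.mem_univ _) ?_
    simp only [Cyc, T3]
    decide
  | succ n ih =>
    intro X hX
    exact (card_le_of_acyclic_subst ih X hX).trans_eq (pow_succ' 2 (n + 1)).symm

/-- The tournament induced along an injection. -/
def comap {V W : Type*} (G : Tournament V) (f : W ↪ V) : Tournament W where
  Adj u v := G.Adj (f u) (f v)
  loopless v := G.loopless (f v)
  exactly_one u v h := G.exactly_one (f u) (f v) fun e => h (f.injective e)

theorem IsFree.comap {U V W : Type*} {G : Tournament V} {H : Tournament U} (h : G.IsFree H)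
    (f : W ↪ V) : (G.comap f).IsFree H :=
  isFree_iff.2 fun g hg => isFree_iff.1 h (fun i => f (g i)) hg

theorem Acyclic.map {V W : Type*} {G : Tournament V} {f : W ↪ V} {X : Finset W}
    (hX : (G.comap f).Acyclic X) : G.Acyclic (X.map f) := by
  simp only [Acyclic, Finset.mem_map]
  rintro _ ⟨a, ha, rfl⟩ _ ⟨b, hb, rfl⟩ _ ⟨c, hc, rfl⟩ ht
  exact hX a ha b hb c hc ht

theorem three_pow_rpow_logb (n : ℕ) : ((3 ^ n : ℕ) : ℝ) ^ Real.logb 3 2 = (2 ^ n : ℕ) := by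
  push_cast
  rw [← Real.rpow_natCast, ← Real.rpow_mul (by norm_num), mul_comm,
    Real.rpow_mul (by norm_num), Real.rpow_logb (by norm_num) (by norm_num) (by norm_num),
    Real.rpow_natCast]

theorem exists_isFree_fin (n : ℕ) : ∃ G : Tournament (Fin (3 ^ (n + 1))), G.IsFree U5 ∧
    ∀ X : Finset (Fin (3 ^ (n + 1))), (G.induce (X : Set _)).IsTransitive →
      (X.card : ℝ) ≤ ((3 ^ (n + 1) : ℕ) : ℝ) ^ Real.logb 3 2 := by
  have := finite_iterVertex n
  let e := (Finite.equivFinOfCardEq (card_iterVertex n)).symm.toEmbedding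
  refine ⟨(iterT3 (n + 1)).comap e, (isFree_iterT3 n).comap e, fun X hX => ?_⟩
  have h1 := card_le_of_acyclic_iterT3 n _ (isTransitive_induce_iff.1 hX).map
  rw [Finset.card_map] at h1
  rw [three_pow_rpow_logb]
  exact_mod_cast h1

end Tournament

theorem mainTheorem3 :
    (∀ (V : Type*) [Fintype V] (G : Tournament V), G.IsFree Tournament.U5 →
      ∃ X : Finset V, (G.induce (X : Set V)).IsTransitive ∧
        (Fintype.card V : ℝ) ^ Real.logb 3 2 ≤ (X.card : ℝ)) ∧
    (∀ n : ℕ, 1 ≤ n →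
      (Tournament.iterT3 n).IsFree Tournament.U5 ∧
      Nat.card (Tournament.IterVertex n) = 3 ^ n ∧
      ∀ X : Finset (Tournament.IterVertex n),
        ((Tournament.iterT3 n).induce (X : Set (Tournament.IterVertex n))).IsTransitive →
          X.card ≤ 2 ^ n) ∧
    {m : ℕ | ∃ G : Tournament (Fin m), G.IsFree Tournament.U5 ∧
      ∀ X : Finset (Fin m), (G.induce (X : Set (Fin m))).IsTransitive →
        (X.card : ℝ) ≤ (m : ℝ) ^ Real.logb 3 2}.Infinite := by
  refine ⟨fun V _ G hG => hG.exists_transitive, fun n hn => ?_, ?_⟩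
  · obtain ⟨n, rfl⟩ := Nat.exists_eq_add_of_le' hn
    exact ⟨Tournament.isFree_iterT3 n, Tournament.card_iterVertex n, fun X hX =>
      Tournament.card_le_of_acyclic_iterT3 n X (Tournament.isTransitive_induce_iff.1 hX)⟩
  · refine Set.infinite_of_injective_forall_mem (f := fun n : ℕ => 3 ^ (n + 1)) ?_
      Tournament.exists_isFree_fin
    exact (Nat.pow_right_injective (le_refl 2 |>.trans (by norm_num))).comp (add_left_injective 1)
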